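/- Let $k$ be a field and $A$ a finite-dimensional $k$-algebra with Jacobson radical $r$, and suppose $A = E\oplus r$ as vector spaces, where $E$ is a subalgebra of $A$ isomorphic to a product $k\times\cdots\times k$ of finitely many copies of $k$. Let $\pi:A\to r$ be the projection along $E$ and $E_0$ the set of primitive idempotents of $E$. Let $C^n(A,A)=\mathrm{Hom}_k(A^{\otimes_k n},A)$ be the Hochschild cochains, and let $C^n_E(r,A)=\mathrm{Hom}_{E^e}(r^{\otimes_E n},A)$ be the reduced cochains (with $C^0(A,A)=A$ and $C^0_E(r,A)=A^E=\{a\in A: ae=ea \text{ for all } e\in E\}$), both with the differential $$\delta f(x_1\otimes\cdots\otimes x_{n+1})=x_1f(x_2\otimes\cdots\otimes x_{n+1})+\sum_{i=1}^n(-1)^if(x_1\otimes\cdots\otimes x_ix_{i+1}\otimes\cdots\otimes x_{n+1})+(-1)^{n+1}f(x_1\otimes\cdots\otimes x_n)x_{n+1}.$$ For $n,m\ge 1$ put, for Hochschild cochains $f$ of arity $n$ and $g$ of arity $m$, $$f\circ_i g(x_1\otimes\cdots\otimes x_{n+m-1})=f(x_1\otimes\cdots\otimes g(x_i\otimes\cdots\otimes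 x_{i+m-1})\otimes\cdots\otimes x_{n+m-1}),\qquad f\circ g=\sum_{i=1}^n(-1)^{(i-1)(m-1)}f\circ_i g,$$ and $[f,g]=f\circ g-(-1)^{(n-1)(m-1)}g\circ f$ (the Gerstenhaber bracket). For reduced cochains define the reduced bracket $[f,g]_R$ by the same formulas with $g(x_i\otimes\cdots\otimes x_{i+m-1})$ replaced by $\pi g(x_i\otimes\cdots\otimes x_{i+m-1})$. Define $p^n:C^n_E(r,A)\to C^n(A,A)$ and $s^n:C^n(A,A)\to C^n_E(r,A)$ by $$p^nf(x_1\otimes\cdots\otimes x_n)=f(\pi(x_1)\otimes\cdots\otimes\pi(x_n)),$$ $$s^nf(x_1\otimes\cdots\otimes x_n)=\sum_{e_0,\dots,e_n\in E_0}e_0\,f(e_0x_1e_1\otimes e_1x_2e_2\otimes\cdots\otimes e_{n-1}x_ne_n)\,e_n .$$ A graded Lie bracket on a graded space is a graded bilinear operation satisfying graded antisymmetry $[x,y]=-(-1)^{|x||y|}[y,x]$ and the graded Jacobi identity $(-1)^{|x||z|}[x,[y,z]]+(-1)^{|y||x|}[y,[z,x]]+(-1)^{|z||y|}[z,[x,y]]=0$;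 cochains (and cohomology classes) of arity $n$ have degree $n-1$. Then: 1. The Gerstenhaber bracket is a graded Lie bracket on $C^{*+1}(A,A)=\bigoplus_{n\ge1}C^n(A,A)$, and the reduced bracket is a graded Lie bracket on $C_E^{*+1}(r,A)=\bigoplus_{n\ge1}C^n_E(r,A)$. 2. For $n,m\geq 1$, $f\in C^n_E(r,A)$ and $g\in C^m_E(r,A)$, one has $[f,g]_R=s^{n+m-1}[p^nf,p^mg]$ and $p^{n+m-1}[f,g]_R=[p^nf,p^mg]$. In particular $p^*$ is a morphism of graded Lie algebras. Moreover $p^{n+1}\delta=\delta p^n$ for all $n\geq 0$. 3. For such $f,g$: $\delta[f,g]_R=[f,\delta g]_R+(-1)^{m-1}[\delta f,g]_R$. 4. The reduced bracket induces a well-defined graded Lie bracket on the cohomology $\bigoplus_{n\ge1}H^n(C_E^\bullet(r,A))$ of the reduced complex, the Gerstenhaber bracket induces one on $\bigoplus_{n\ge1}H^n(C^\bullet(A,A))=HH^{*+1}(A)$, and the maps $p^n$ induce linear isomorphisms $H^n(C_E^\bullet(r,A))\to HH^n(A)$, $n\ge1$, compatible with these brackets. Thus $HH^{*+1}(A)$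 with the reduced bracket (computed by the reduced complex) and $HH^{*+1}(A)$ with the Gerstenhaber bracket are isomorphic graded Lie algebras. -/

import Mathlib

noncomputable section

namespace ReducedBracket

/-! ### Graded Lie brackets and cohomology -/

section Graded

variable {k : Type*} [Field k]

/-- A family of bilinear maps `L p × L q → L r`, one for every `p + q = r`, is a graded Lie bracket
on `⨁ p, L p` if it is graded antisymmetric, `[x, y] = -(-1)^{pq} [y, x]`, and satisfies the
graded Jacobi identity
`(-1)^{pr} [x, [y, z]] + (-1)^{qp} [y, [z, x]] + (-1)^{rq} [z, [x, y]] = 0`,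
for `x, y, z` of degrees `p, q, r`. -/
structure IsGradedLieBracket {L : ℕ → Type*} [∀ p, AddCommGroup (L p)] [∀ p, Module k (L p)]
    (br : ∀ {p q r : ℕ}, p + q = r → (L p →ₗ[k] L q →ₗ[k] L r)) : Prop where
  antisymm : ∀ {p q s : ℕ} (h : p + q = s) (h' : q + p = s) (x : L p) (y : L q),
    br h x y = -((-1 : k) ^ (p * q) • br h' y x)
  jacobi : ∀ {p q r qr rp pq s : ℕ} (hqr : q + r = qr) (hrp : r + p = rp) (hpq : p + q = pq)
    (h₁ : p + qr = s) (h₂ : q + rp = s) (h₃ : r + pq = s) (x : L p) (y : L q) (z : L r),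
    (-1 : k) ^ (p * r) • br h₁ x (br hqr y z) + (-1 : k) ^ (q * p) • br h₂ y (br hrp z x)
      + (-1 : k) ^ (r * q) • br h₃ z (br hpq x y) = 0

variable {C : ℕ → Type*} [∀ n, AddCommGroup (C n)] [∀ n, Module k (C n)]

/-- The cocycles of degree `p + 1` of a cochain complex `(C, d)`. -/
abbrev Cocycle (d : ∀ n, C n →ₗ[k] C (n + 1)) (p : ℕ) : Submodule k (C (p + 1)) :=
  LinearMap.ker (d (p + 1))

/-- The cohomology `H^{p+1} = ker d^{p+1} / im d^p` of a cochain complex `(C, d)`. -/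
abbrev CohomologySucc (d : ∀ n, C n →ₗ[k] C (n + 1)) (p : ℕ) : Type _ :=
  Cocycle d p ⧸ (LinearMap.range (d p)).submoduleOf (Cocycle d p)

/-- The cohomology class of a cocycle. -/
abbrev cohomologyClass (d : ∀ n, C n →ₗ[k] C (n + 1)) (p : ℕ) :
    Cocycle d p →ₗ[k] CohomologySucc d p :=
  ((LinearMap.range (d p)).submoduleOf (Cocycle d p)).mkQ

end Graded

/-! ### Insertion of multilinear maps -/

section Insertion

variable {k V W : Type*} [Field k] [AddCommGroup V] [Module k V] [AddCommGroup W] [Module k W]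

/-- The tuple `(x₁, …, G(xᵢ, …, x_{i+q}), …, x_{n+q})` of length `n`
(in the code all positions are counted from `0`). -/
def insertArgs {n q N : ℕ} (h : n + q = N) (i : Fin n)
    (G : MultilinearMap k (fun _ : Fin (q + 1) => V) V) (x : Fin N → V) : Fin n → V :=
  fun j =>
    if j < i then x ⟨j, by omega⟩
    else if j = i then G (fun l : Fin (q + 1) => x ⟨i + l, by omega⟩)
    else x ⟨j + q, by omega⟩

theorem insertArgs_update {n q N : ℕ} (h : n + q = N) (i : Fin n)
    (G : MultilinearMap k (fun _ : Fin (q + 1) => V) V) (x : Fin N → V) (t : Fin N) :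
    (∃ s : Fin n, ∀ a, insertArgs h i G (Function.update x t a) =
      Function.update (insertArgs h i G x) s a) ∨
    (∃ l : Fin (q + 1), ∀ a, insertArgs h i G (Function.update x t a) =
      Function.update (insertArgs h i G x) i
        (G (Function.update (fun l : Fin (q + 1) => x ⟨i + l, by omega⟩) l a))) := by
  have key : ∀ (a : V), (t.val < i.val ∨ i.val + q < t.val) →
      (fun l : Fin (q + 1) => Function.update x t a ⟨i + l, by omega⟩)
        = (fun l : Fin (q + 1) => x ⟨i + l, by omega⟩) := by
    intro a ht
    funext l
    rw [Function.update_of_ne]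
    intro e
    have := congrArg Fin.val e
    have := l.2
    simp only at *
    omega
  by_cases h1 : t.val < i.val
  · left
    refine ⟨⟨t, by omega⟩, fun a => ?_⟩
    funext j
    simp only [insertArgs, key a (Or.inl h1)]
    simp only [insertArgs, Function.update_apply, Fin.ext_iff, Fin.lt_def]
    split_ifs <;> first | rfl | omega
  by_cases h2 : i.val + q < t.val
  · left
    refine ⟨⟨t - q, by omega⟩, fun a => ?_⟩
    funext j
    simp only [insertArgs, key a (Or.inr h2)]
    simp only [insertArgs, Function.update_apply, Fin.ext_iff, Fin.lt_def]
    split_ifs <;> first | rfl | omega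
  · right
    refine ⟨⟨t - i, by omega⟩, fun a => ?_⟩
    have hb : (fun l : Fin (q + 1) => Function.update x t a ⟨i + l, by omega⟩)
        = Function.update (fun l : Fin (q + 1) => x ⟨i + l, by omega⟩) ⟨t - i, by omega⟩ a := by
      funext l
      simp only [Function.update_apply, Fin.ext_iff]
      split_ifs <;> first | rfl | omega
    funext j
    simp only [insertArgs, hb]
    simp only [Function.update_apply (f := insertArgs h i G x)]
    simp only [insertArgs, Function.update_apply (f := x), Fin.ext_iff, Fin.lt_def]
    split_ifs <;> first | rfl | omega

/-- The partial composition `F ∘ᵢ G`: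
`(x₁, …, x_{n+q}) ↦ F(x₁, …, G(xᵢ, …, x_{i+q}), …, x_{n+q})`. -/
def insertAt {n q N : ℕ} (h : n + q = N) (i : Fin n)
    (F : MultilinearMap k (fun _ : Fin n => V) W)
    (G : MultilinearMap k (fun _ : Fin (q + 1) => V) V) :
    MultilinearMap k (fun _ : Fin N => V) W where
  toFun x := F (insertArgs h i G x)
  map_update_add' {inst} x t a b := by
    obtain rfl : inst = instDecidableEqFin N := Subsingleton.elim _ _
    rcases insertArgs_update h i G x t with ⟨s, hs⟩ | ⟨l, hl⟩
    · simp only [hs, MultilinearMap.map_update_add]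
    · simp only [hl, MultilinearMap.map_update_add]
  map_update_smul' {inst} x t c a := by
    obtain rfl : inst = instDecidableEqFin N := Subsingleton.elim _ _
    rcases insertArgs_update h i G x t with ⟨s, hs⟩ | ⟨l, hl⟩
    · simp only [hs, MultilinearMap.map_update_smul]
    · simp only [hl, MultilinearMap.map_update_smul]

theorem insertAt_apply {n q N : ℕ} (h : n + q = N) (i : Fin n)
    (F : MultilinearMap k (fun _ : Fin n => V) W)
    (G : MultilinearMap k (fun _ : Fin (q + 1) => V) V) (x : Fin N → V) :
    insertAt h i F G x = F (insertArgs h i G x) := rfl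

theorem insertArgs_eq_update {n q N : ℕ} (h : n + q = N) (i : Fin n)
    (G G' : MultilinearMap k (fun _ : Fin (q + 1) => V) V) (x : Fin N → V) :
    insertArgs h i G x = Function.update (insertArgs h i G' x) i
      (G (fun l : Fin (q + 1) => x ⟨i + l, by omega⟩)) := by
  funext j
  simp only [Function.update_apply, insertArgs]
  split_ifs <;> first | rfl | omega

theorem insertAt_add_left {n q N : ℕ} (h : n + q = N) (i : Fin n)
    (F F' : MultilinearMap k (fun _ : Fin n => V) W)
    (G : MultilinearMap k (fun _ : Fin (q + 1) => V) V) :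
    insertAt h i (F + F') G = insertAt h i F G + insertAt h i F' G := rfl

theorem insertAt_smul_left {n q N : ℕ} (h : n + q = N) (i : Fin n) (c : k)
    (F : MultilinearMap k (fun _ : Fin n => V) W)
    (G : MultilinearMap k (fun _ : Fin (q + 1) => V) V) :
    insertAt h i (c • F) G = c • insertAt h i F G := rfl

theorem insertAt_add_right {n q N : ℕ} (h : n + q = N) (i : Fin n)
    (F : MultilinearMap k (fun _ : Fin n => V) W)
    (G G' : MultilinearMap k (fun _ : Fin (q + 1) => V) V) :
    insertAt h i F (G + G') = insertAt h i F G + insertAt h i F G' := by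
  ext x
  simp only [add_apply, insertAt_apply]
  rw [insertArgs_eq_update h i (G + G') 0, insertArgs_eq_update h i G 0,
    insertArgs_eq_update h i G' 0, add_apply, MultilinearMap.map_update_add]

theorem insertAt_smul_right {n q N : ℕ} (h : n + q = N) (i : Fin n) (c : k)
    (F : MultilinearMap k (fun _ : Fin n => V) W)
    (G : MultilinearMap k (fun _ : Fin (q + 1) => V) V) :
    insertAt h i F (c • G) = c • insertAt h i F G := by
  ext x
  simp only [smul_apply, insertAt_apply]
  rw [insertArgs_eq_update h i (c • G) 0, insertArgs_eq_update h i G 0,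
    smul_apply, MultilinearMap.map_update_smul]

/-- A bilinear map `V × V → V`, seen as a multilinear map in two variables. -/
def bilinTwo (m : V →ₗ[k] V →ₗ[k] V) : MultilinearMap k (fun _ : Fin (1 + 1) => V) V where
  toFun x := m (x 0) (x 1)
  map_update_add' {inst} x t a b := by
    obtain rfl : inst = instDecidableEqFin 2 := Subsingleton.elim _ _
    revert t
    refine Fin.forall_fin_two.2 ⟨?_, ?_⟩ <;> simp
  map_update_smul' {inst} x t c a := by
    obtain rfl : inst = instDecidableEqFin 2 := Subsingleton.elim _ _
    revert t
    refine Fin.forall_fin_two.2 ⟨?_, ?_⟩ <;> simp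

end Insertion

/-! ### The formulas for the differential and for the bracket

Both complexes consist of multilinear maps `Vⁿ → A`, where `V = A` (all of `A`, over `k`) or
`V = r` (the radical). The formulas are the same for the two; they use the inclusion
`ι : V → A`, the multiplication `m` of `V` and the projection `π : A → V`. -/

section Formulas

variable {k V A : Type*} [Field k] [AddCommGroup V] [Module k V] [Ring A] [Algebra k A]

/-- The map `(x₁, …, x_{n+1}) ↦ x₁ f(x₂, …, x_{n+1})`. -/
def mulLeftTerm (ι : V →ₗ[k] A) {n : ℕ} (f : MultilinearMap k (fun _ : Fin n => V) A) :
    MultilinearMap k (fun _ : Fin (n + 1) => V) A where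
  toFun x := ι (x 0) * f (Fin.tail x)
  map_update_add' {inst} x t a b := by
    obtain rfl : inst = instDecidableEqFin (n + 1) := Subsingleton.elim _ _
    refine Fin.cases ?_ (fun t => ?_) t
    · simp [add_mul]
    · simp [Fin.tail_update_succ, mul_add, Function.update_of_ne (Fin.succ_ne_zero t).symm]
  map_update_smul' {inst} x t c a := by
    obtain rfl : inst = instDecidableEqFin (n + 1) := Subsingleton.elim _ _
    refine Fin.cases ?_ (fun t => ?_) t
    · simp
    · simp [Fin.tail_update_succ, Function.update_of_ne (Fin.succ_ne_zero t).symm]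

/-- The map `(x₁, …, x_{n+1}) ↦ f(x₁, …, x_n) x_{n+1}`. -/
def mulRightTerm (ι : V →ₗ[k] A) {n : ℕ} (f : MultilinearMap k (fun _ : Fin n => V) A) :
    MultilinearMap k (fun _ : Fin (n + 1) => V) A where
  toFun x := f (Fin.init x) * ι (x (Fin.last n))
  map_update_add' {inst} x t a b := by
    obtain rfl : inst = instDecidableEqFin (n + 1) := Subsingleton.elim _ _
    refine Fin.lastCases ?_ (fun t => ?_) t
    · simp [mul_add]
    · simp [Fin.init_update_castSucc, add_mul,
        Function.update_of_ne (Fin.castSucc_lt_last t).ne']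
  map_update_smul' {inst} x t c a := by
    obtain rfl : inst = instDecidableEqFin (n + 1) := Subsingleton.elim _ _
    refine Fin.lastCases ?_ (fun t => ?_) t
    · simp
    · simp [Fin.init_update_castSucc, Function.update_of_ne (Fin.castSucc_lt_last t).ne']

/-- The differential
`δf(x₁, …, x_{n+1}) = x₁ f(x₂, …, x_{n+1}) + ∑ᵢ (-1)ⁱ f(x₁, …, xᵢ x_{i+1}, …, x_{n+1})
  + (-1)^{n+1} f(x₁, …, x_n) x_{n+1}`.
For `n = 0`, where `f` is an element `a` of `A`, this reads `δ(a)(x) = x a - a x`. -/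
def differential (ι : V →ₗ[k] A) (m : V →ₗ[k] V →ₗ[k] V) (n : ℕ) :
    MultilinearMap k (fun _ : Fin n => V) A →ₗ[k]
      MultilinearMap k (fun _ : Fin (n + 1) => V) A where
  toFun f := mulLeftTerm ι f
    + ∑ i : Fin n, (-1 : k) ^ (i.val + 1) • insertAt (q := 1) rfl i f (bilinTwo m)
    + (-1 : k) ^ (n + 1) • mulRightTerm ι f
  map_add' f g := by
    ext x
    simp [mulLeftTerm, mulRightTerm, insertAt_add_left, mul_add, add_mul, Finset.sum_add_distrib]
    abel
  map_smul' c f := by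
    ext x
    simp [mulLeftTerm, mulRightTerm, insertAt_smul_left, Finset.smul_sum, smul_comm c]

/-- For `f` of arity `p + 1` and `g` of arity `q + 1`, the operation
`f ∘ g = ∑ᵢ (-1)^{(i-1) q} f ∘ᵢ g`, with
`f ∘ᵢ g (x₁, …, x_{p+q+1}) = f(x₁, …, π g(xᵢ, …, x_{i+q}), …, x_{p+q+1})`. -/
def preLie (π : A →ₗ[k] V) {p q r : ℕ} (h : p + q = r)
    (f : MultilinearMap k (fun _ : Fin (p + 1) => V) A)
    (g : MultilinearMap k (fun _ : Fin (q + 1) => V) A) :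
    MultilinearMap k (fun _ : Fin (r + 1) => V) A :=
  ∑ i : Fin (p + 1), (-1 : k) ^ (i.val * q) •
    insertAt (by omega) i f (π.compMultilinearMap g)

theorem preLie_bilin (π : A →ₗ[k] V) {p q r : ℕ} (h : p + q = r) :
    (∀ f f' g, preLie π h (f + f') g = preLie π h f g + preLie π h f' g) ∧
    (∀ (c : k) f g, preLie π h (c • f) g = c • preLie π h f g) ∧
    (∀ f g g', preLie π h f (g + g') = preLie π h f g + preLie π h f g') ∧
    (∀ (c : k) f g, preLie π h f (c • g) = c • preLie π h f g) := by
  have e1 : ∀ g g' : MultilinearMap k (fun _ : Fin (q + 1) => V) A,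
      π.compMultilinearMap (g + g') = π.compMultilinearMap g + π.compMultilinearMap g' :=
    fun g g' => by ext; simp
  have e2 : ∀ (c : k) (g : MultilinearMap k (fun _ : Fin (q + 1) => V) A),
      π.compMultilinearMap (c • g) = c • π.compMultilinearMap g :=
    fun c g => by ext; simp
  refine ⟨?_, ?_, ?_, ?_⟩ <;> intros <;>
    simp only [preLie, e1, e2, insertAt_add_left, insertAt_smul_left, insertAt_add_right,
      insertAt_smul_right,
      smul_add, Finset.sum_add_distrib, Finset.smul_sum, smul_comm ((-1 : k) ^ _)]

/-- The graded commutator `[f, g] = f ∘ g - (-1)^{pq} g ∘ f`, where `f` has arity `p + 1`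
(degree `p`) and `g` has arity `q + 1` (degree `q`). -/
def gradedCommutator (π : A →ₗ[k] V) {p q r : ℕ} (h : p + q = r) :
    MultilinearMap k (fun _ : Fin (p + 1) => V) A →ₗ[k]
      MultilinearMap k (fun _ : Fin (q + 1) => V) A →ₗ[k]
        MultilinearMap k (fun _ : Fin (r + 1) => V) A :=
  LinearMap.mk₂ k
    (fun f g => preLie π h f g - (-1 : k) ^ (p * q) • preLie π (by omega : q + p = r) g f)
    (fun f f' g => by
      simp only [(preLie_bilin π h).1, (preLie_bilin π (by omega : q + p = r)).2.2.1, smul_add]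
      abel)
    (fun c f g => by
      simp only [(preLie_bilin π h).2.1, (preLie_bilin π (by omega : q + p = r)).2.2.2, smul_sub,
        smul_comm c])
    (fun f g g' => by
      simp only [(preLie_bilin π h).2.2.1, (preLie_bilin π (by omega : q + p = r)).1, smul_add]
      abel)
    (fun c f g => by
      simp only [(preLie_bilin π h).2.2.2, (preLie_bilin π (by omega : q + p = r)).2.1, smul_sub,
        smul_comm c])

theorem gradedCommutator_apply (π : A →ₗ[k] V) {p q r : ℕ} (h : p + q = r)
    (f : MultilinearMap k (fun _ : Fin (p + 1) => V) A)
    (g : MultilinearMap k (fun _ : Fin (q + 1) => V) A) :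
    gradedCommutator π h f g =
      preLie π h f g - (-1 : k) ^ (p * q) • preLie π (by omega : q + p = r) g f := rfl

end Formulas

/-! ### The Hochschild complex and the Gerstenhaber bracket -/

section Hochschild

variable (k A : Type*) [Field k] [Ring A] [Algebra k A]

/-- The Hochschild cochains `Cⁿ(A, A) = Hom_k(A^{⊗n}, A)`. -/
abbrev HochschildCochain (n : ℕ) : Type _ := MultilinearMap k (fun _ : Fin n => A) A

/-- The Hochschild differential. -/
def hochschildDiff (n : ℕ) : HochschildCochain k A n →ₗ[k] HochschildCochain k A (n + 1) :=
  differential LinearMap.id (LinearMap.mul k A) n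

/-- The Gerstenhaber bracket on `C^{*+1}(A, A)`; degree `p` is `C^{p+1}(A, A)`. -/
def gerstenhaberBracket {p q r : ℕ} (h : p + q = r) :
    HochschildCochain k A (p + 1) →ₗ[k] HochschildCochain k A (q + 1) →ₗ[k]
      HochschildCochain k A (r + 1) :=
  gradedCommutator LinearMap.id h

/-- The Hochschild cocycles of degree `p + 1`. -/
abbrev HochschildCocycle (p : ℕ) : Submodule k (HochschildCochain k A (p + 1)) :=
  Cocycle (C := HochschildCochain k A) (hochschildDiff k A) p

/-- The Hochschild cohomology `HH^{p+1}(A)`. -/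
abbrev HochschildHH (p : ℕ) : Type _ :=
  CohomologySucc (C := HochschildCochain k A) (hochschildDiff k A) p

/-- The class of a Hochschild cocycle. -/
abbrev hochschildClass (p : ℕ) : HochschildCocycle k A p →ₗ[k] HochschildHH k A p :=
  cohomologyClass (C := HochschildCochain k A) (hochschildDiff k A) p

end Hochschild

/-! ### The reduced complex and the reduced bracket -/

section Reduced

variable (k A : Type*) [Field k] [Ring A] [Algebra k A]

/-- The Jacobson radical `r` of `A`, as a `k`-subspace. -/
abbrev rad : Submodule k A := (Ring.jacobson A).restrictScalars k

/-- A decomposition `A = E ⊕ r`, where `r` is the Jacobson radical and `E` is a subalgebra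
isomorphic to a product `k × ⋯ × k` of `N` copies of `k`. -/
structure RadicalSplitting (N : ℕ) where
  E : Subalgebra k A
  equiv : E ≃ₐ[k] (Fin N → k)
  isCompl : IsCompl (Subalgebra.toSubmodule E) (rad k A)

variable {k A}

theorem mul_mem_rad_left (a : A) {x : A} (hx : x ∈ rad k A) : a * x ∈ rad k A :=
  (Ring.jacobson A).mul_mem_left a hx

theorem mul_mem_rad_right (a : A) {x : A} (hx : x ∈ rad k A) : x * a ∈ rad k A :=
  (Ring.jacobson A).mul_mem_right a hx

variable (k A) in
/-- The multiplication of `r`. -/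
def radMul : rad k A →ₗ[k] rad k A →ₗ[k] rad k A :=
  LinearMap.mk₂ k (fun x y => ⟨(x : A) * y, mul_mem_rad_left _ y.2⟩)
    (fun _ _ _ => Subtype.ext (add_mul _ _ _)) (fun _ _ _ => Subtype.ext (smul_mul_assoc _ _ _))
    (fun _ _ _ => Subtype.ext (mul_add _ _ _)) (fun _ _ _ => Subtype.ext (mul_smul_comm _ _ _))

namespace RadicalSplitting

variable {N : ℕ} (D : RadicalSplitting k A N)

/-- The projection `π : A → r` along `E`. -/
def proj : A →ₗ[k] rad k A := (rad k A).projectionOnto _ D.isCompl.symm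

/-- The primitive orthogonal idempotents `e₁, …, e_N` of `E`. -/
def idem (j : Fin N) : A := (D.equiv.symm (Pi.single j 1) : D.E)

/-- `F : rⁿ → A` induces a morphism of `E`-bimodules on the tensor power `r^{⊗n}` over `E`, where
`r^{⊗0} = E`: it satisfies `F(e x₁, …) = e F(x₁, …)`, `F(…, x_n e) = F(…, x_n) e` and
`F(…, xᵢ e, x_{i+1}, …) = F(…, xᵢ, e x_{i+1}, …)`, and, if `n = 0`, its value commutes
with `E`. -/
structure IsBimoduleMap {n : ℕ} (F : (Fin n → rad k A) → A) : Prop where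
  zero : n = 0 → ∀ e ∈ D.E, ∀ x, e * F x = F x * e
  left : ∀ (h : 0 < n), ∀ e ∈ D.E, ∀ x y : Fin n → rad k A,
    (y ⟨0, h⟩ : A) = e * x ⟨0, h⟩ → (∀ j : Fin n, j.val ≠ 0 → y j = x j) → F y = e * F x
  right : ∀ (h : 0 < n), ∀ e ∈ D.E, ∀ x y : Fin n → rad k A,
    (y ⟨n - 1, by omega⟩ : A) = x ⟨n - 1, by omega⟩ * e →
    (∀ j : Fin n, j.val ≠ n - 1 → y j = x j) → F y = F x * e
  mid : ∀ (i : ℕ) (h : i + 1 < n), ∀ e ∈ D.E, ∀ x y : Fin n → rad k A,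
    (x ⟨i, by omega⟩ : A) = y ⟨i, by omega⟩ * e → (y ⟨i + 1, h⟩ : A) = e * x ⟨i + 1, h⟩ →
    (∀ j : Fin n, j.val ≠ i → j.val ≠ i + 1 → x j = y j) → F x = F y

/-- The reduced cochains `C^n_E(r, A) = Hom_{E^e}(r^{⊗n}, A)`, the tensor power being taken
over `E`. For `n = 0` this is `A^E`. -/
def reducedCochain (n : ℕ) : Submodule k (MultilinearMap k (fun _ : Fin n => rad k A) A) where
  carrier := {f | D.IsBimoduleMap f}
  add_mem' {f g} hf hg :=
    { zero := fun h e he x => by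
        simp [mul_add, add_mul, hf.zero h e he x, hg.zero h e he x]
      left := fun h e he x y h0 h1 => by
        simp [mul_add, hf.left h e he x y h0 h1, hg.left h e he x y h0 h1]
      right := fun h e he x y h0 h1 => by
        simp [add_mul, hf.right h e he x y h0 h1, hg.right h e he x y h0 h1]
      mid := fun i h e he x y h0 h1 h2 => by
        simp [hf.mid i h e he x y h0 h1 h2, hg.mid i h e he x y h0 h1 h2] }
  zero_mem' :=
    { zero := fun h e he x => by simp
      left := fun h e he x y h0 h1 => by simp
      right := fun h e he x y h0 h1 => by simp
      mid := fun i h e he x y h0 h1 h2 => by simp }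
  smul_mem' c f hf :=
    { zero := fun h e he x => by simp [hf.zero h e he x]
      left := fun h e he x y h0 h1 => by simp [hf.left h e he x y h0 h1]
      right := fun h e he x y h0 h1 => by simp [hf.right h e he x y h0 h1]
      mid := fun i h e he x y h0 h1 h2 => by simp [hf.mid i h e he x y h0 h1 h2] }

variable {D}

theorem isBimoduleMap_insertAt {n q M : ℕ} (h : n + q = M) (i : Fin n)
    {F : MultilinearMap k (fun _ : Fin n => rad k A) A}
    {G : MultilinearMap k (fun _ : Fin (q + 1) => rad k A) (rad k A)}
    (hF : D.IsBimoduleMap F) (hG : D.IsBimoduleMap (fun x => (G x : A))) :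
    D.IsBimoduleMap (insertAt h i F G) := by
  have hi := i.2
  -- the values of the tuple `insertArgs`
  have lt : ∀ (x : Fin M → rad k A) (j : ℕ) (hj : j < n) (hj' : j < M), j < i.val →
      insertArgs h i G x ⟨j, hj⟩ = x ⟨j, hj'⟩ := by
    intro x j hj hj' hji
    simp [insertArgs, Fin.lt_def, hji]
  have eq : ∀ (x : Fin M → rad k A) (j : ℕ) (hj : j < n), j = i.val →
      insertArgs h i G x ⟨j, hj⟩ = G (fun l : Fin (q + 1) => x ⟨i + l, by omega⟩) := by
    intro x j hj hji
    simp [insertArgs, hji]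
  have gt : ∀ (x : Fin M → rad k A) (j : ℕ) (hj : j < n) (hj' : j + q < M), i.val < j →
      insertArgs h i G x ⟨j, hj⟩ = x ⟨j + q, hj'⟩ := by
    intro x j hj hj' hji
    simp [insertArgs, Fin.lt_def, Fin.ext_iff, hji.not_gt, hji.ne']
  -- outside the modified slots
  have agree : ∀ (x y : Fin M → rad k A) (j : Fin n),
      (j.val < i.val → ∀ t : Fin M, t.val = j.val → x t = y t) →
      (j.val = i.val → ∀ t : Fin M, i.val ≤ t.val → t.val ≤ i.val + q → x t = y t) →
      (i.val < j.val → ∀ t : Fin M, t.val = j.val + q → x t = y t) →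
      insertArgs h i G x j = insertArgs h i G y j := by
    rintro x y ⟨j, hj⟩ h1 h2 h3
    rcases lt_trichotomy j i.val with hji | hji | hji
    · rw [lt x j hj (by omega) hji, lt y j hj (by omega) hji]
      exact h1 hji _ rfl
    · rw [eq x j hj hji, eq y j hj hji]
      congr 1
      funext l
      exact h2 hji _ (by simp) (by simp; omega)
    · rw [gt x j hj (by omega) hji, gt y j hj (by omega) hji]
      exact h3 hji _ rfl
  refine ⟨fun h0 => by omega, ?_, ?_, ?_⟩
  · intro hM e he x y h0 h1
    have h1' : ∀ t : Fin M, t.val ≠ 0 → y t = x t := h1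
    refine hF.left (by omega) e he _ _ ?_ ?_
    · by_cases hi0 : 0 = i.val
      · rw [eq x 0 _ hi0, eq y 0 _ hi0]
        refine hG.left (by omega) e he _ _ ?_ ?_
        · have : (⟨i.val + 0, by omega⟩ : Fin M) = ⟨0, hM⟩ := Fin.ext (by simp; omega)
          simpa only [this] using h0
        · intro l hl
          exact h1' _ (by simp only; omega)
      · rw [lt x 0 _ hM (by omega), lt y 0 _ hM (by omega)]
        exact h0
    · intro j hj
      refine agree y x j (fun _ t ht => h1' t (by omega)) (fun hji t ht _ => h1' t (by omega))
        (fun hji t ht => h1' t (by omega))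
  · intro hM e he x y h0 h1
    have h1' : ∀ t : Fin M, t.val ≠ M - 1 → y t = x t := h1
    refine hF.right (by omega) e he _ _ ?_ ?_
    · by_cases hi0 : n - 1 = i.val
      · rw [eq x _ _ hi0, eq y _ _ hi0]
        refine hG.right (by omega) e he _ _ ?_ ?_
        · have : (⟨i.val + (q + 1 - 1), by omega⟩ : Fin M) = ⟨M - 1, by omega⟩ :=
            Fin.ext (by simp; omega)
          simpa only [this] using h0
        · intro l hl
          exact h1' _ (by simp; omega)
      · have : (⟨n - 1 + q, by omega⟩ : Fin M) = ⟨M - 1, by omega⟩ := Fin.ext (by simp; omega)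
        rw [gt x _ _ (by omega) (by omega), gt y _ _ (by omega) (by omega), this]
        exact h0
    · intro j hj
      have := j.2
      refine agree y x j (fun _ t ht => h1' t (by omega)) (fun hji t ht _ => h1' t (by omega))
        (fun hji t ht => h1' t (by omega))
  · intro t hM e he x y h0 h1 h2
    have h2' : ∀ s : Fin M, s.val ≠ t → s.val ≠ t + 1 → x s = y s := h2
    simp only [insertAt_apply]
    by_cases c1 : t + 1 < i.val
    · refine hF.mid t (by omega) e he _ _ ?_ ?_ ?_
      · rw [lt x t _ (by omega) (by omega), lt y t _ (by omega) (by omega)]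
        exact h0
      · rw [lt x _ _ (by omega) c1, lt y _ _ (by omega) c1]
        exact h1
      · intro j hj hj'
        refine agree x y j (fun _ s hs => h2' s (by omega) (by omega))
          (fun _ s hs _ => h2' s (by omega) (by omega))
          (fun hji s hs => h2' s (by omega) (by omega))
    by_cases c2 : t + 1 = i.val
    · refine hF.mid t (by omega) e he _ _ ?_ ?_ ?_
      · rw [lt x t _ (by omega) (by omega), lt y t _ (by omega) (by omega)]
        exact h0
      · rw [eq x _ _ c2, eq y _ _ c2]
        refine hG.left (by omega) e he _ _ ?_ ?_
        · have : (⟨i.val + 0, by omega⟩ : Fin M) = ⟨t + 1, hM⟩ := Fin.ext (by simp; omega)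
          simpa only [this] using h1
        · intro l hl
          exact (h2' _ (by simp; omega) (by simp; omega)).symm
      · intro j hj hj'
        refine agree x y j (fun _ s hs => h2' s (by omega) (by omega))
          (fun _ s hs _ => h2' s (by omega) (by omega))
          (fun hji s hs => h2' s (by omega) (by omega))
    by_cases c3 : t < i.val + q
    · congr 1
      funext j
      by_cases hj : j.val = i.val
      · obtain ⟨j, hjn⟩ := j
        rw [eq x j hjn hj, eq y j hjn hj]
        apply Subtype.ext
        refine hG.mid (t - i.val) (by omega) e he _ _ ?_ ?_ ?_
        · have : (⟨i.val + (t - i.val), by omega⟩ : Fin M) = ⟨t, by omega⟩ :=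
            Fin.ext (by simp; omega)
          simpa only [this] using h0
        · have : (⟨i.val + (t - i.val + 1), by omega⟩ : Fin M) = ⟨t + 1, by omega⟩ :=
            Fin.ext (by simp; omega)
          simpa only [this] using h1
        · intro l hl hl'
          exact h2' _ (by simp; omega) (by simp; omega)
      · refine agree x y j (fun _ s hs => h2' s (by omega) (by omega))
          (fun hji s hs _ => absurd hji hj)
          (fun hji s hs => h2' s (by omega) (by omega))
    by_cases c4 : t = i.val + q
    · have e1 : (⟨i.val + 1 + q, by omega⟩ : Fin M) = ⟨t + 1, by omega⟩ :=
        Fin.ext (by simp; omega)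
      refine hF.mid i.val (by omega) e he _ _ ?_ ?_ ?_
      · rw [eq x _ _ rfl, eq y _ _ rfl]
        refine hG.right (by omega) e he _ _ ?_ ?_
        · have : (⟨i.val + (q + 1 - 1), by omega⟩ : Fin M) = ⟨t, by omega⟩ :=
            Fin.ext (by simp; omega)
          simpa only [this] using h0
        · intro l hl
          exact h2' _ (by simp; omega) (by simp; omega)
      · rw [gt x _ _ (by omega) (by omega), gt y _ _ (by omega) (by omega), e1]
        exact h1
      · intro j hj hj'
        refine agree x y j (fun _ s hs => h2' s (by omega) (by omega))
          (fun hji => absurd hji hj)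
          (fun hji s hs => h2' s (by omega) (by omega))
    · have e0 : (⟨t - q + q, by omega⟩ : Fin M) = ⟨t, by omega⟩ := Fin.ext (by simp; omega)
      have e1 : (⟨t - q + 1 + q, by omega⟩ : Fin M) = ⟨t + 1, by omega⟩ :=
        Fin.ext (by simp; omega)
      refine hF.mid (t - q) (by omega) e he _ _ ?_ ?_ ?_
      · rw [gt x _ _ (by omega) (by omega), gt y _ _ (by omega) (by omega), e0]
        exact h0
      · rw [gt x _ _ (by omega) (by omega), gt y _ _ (by omega) (by omega), e1]
        exact h1
      · intro j hj hj'
        refine agree x y j (fun _ s hs => h2' s (by omega) (by omega))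
          (fun hji s hs _ => h2' s (by omega) (by omega))
          (fun hji s hs => h2' s (by omega) (by omega))

theorem isBimoduleMap_radMul :
    D.IsBimoduleMap (fun x : Fin (1 + 1) → rad k A => (bilinTwo (radMul k A) x : A)) := by
  have hm : ∀ x : Fin (1 + 1) → rad k A, (bilinTwo (radMul k A) x : A) = (x 0 : A) * x 1 :=
    fun _ => rfl
  refine ⟨fun h => by omega, ?_, ?_, ?_⟩
  · intro h e he x y h0 h1
    have h0' : (y 0 : A) = e * x 0 := h0
    have h1' : y 1 = x 1 := h1 1 (by simp)
    simp only [hm, h0', h1', mul_assoc]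
  · intro h e he x y h0 h1
    have h0' : (y 1 : A) = x 1 * e := h0
    have h1' : y 0 = x 0 := h1 0 (by simp)
    simp only [hm, h0', h1', mul_assoc]
  · intro i h e he x y h0 h1 _
    obtain rfl : i = 0 := by omega
    have h0' : (x 0 : A) = y 0 * e := h0
    have h1' : (y 1 : A) = e * x 1 := h1
    simp only [hm, h0', h1', mul_assoc]

theorem isBimoduleMap_mulLeftTerm {n : ℕ} {F : MultilinearMap k (fun _ : Fin n => rad k A) A}
    (hF : D.IsBimoduleMap F) : D.IsBimoduleMap (mulLeftTerm (rad k A).subtype F) := by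
  have hm : ∀ x : Fin (n + 1) → rad k A,
      mulLeftTerm (rad k A).subtype F x = (x 0 : A) * F (Fin.tail x) := fun _ => rfl
  refine ⟨fun h => by omega, ?_, ?_, ?_⟩
  · intro h e he x y h0 h1
    have h0' : (y 0 : A) = e * x 0 := h0
    have h1' : Fin.tail y = Fin.tail x := funext fun j => h1 j.succ (by simp)
    rw [hm, hm, h0', h1', mul_assoc]
  · intro h e he x y h0 h1
    rw [hm, hm]
    rcases Nat.eq_zero_or_pos n with rfl | hn
    · have h0' : (y 0 : A) = x 0 * e := h0
      rw [h0', mul_assoc, hF.zero rfl e he, mul_assoc, Subsingleton.elim (Fin.tail y) (Fin.tail x)]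
    · have h0' : y 0 = x 0 := h1 0 (by simp; omega)
      rw [h0', mul_assoc]
      congr 1
      refine hF.right hn e he _ _ ?_ ?_
      · have : (⟨n - 1, by omega⟩ : Fin n).succ = ⟨n + 1 - 1, by omega⟩ :=
          Fin.ext (by simp; omega)
        simpa only [Fin.tail, this] using h0
      · intro j hj
        exact h1 j.succ (by simp; omega)
  · intro i h e he x y h0 h1 h2
    rw [hm, hm]
    rcases Nat.eq_zero_or_pos i with rfl | hi
    · have h0' : (x 0 : A) = y 0 * e := h0
      rw [h0', mul_assoc, ← hF.left (by omega) e he (Fin.tail x) (Fin.tail y) h1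
        (fun j hj => (h2 j.succ (by simp) (by simp; omega)).symm)]
    · have h0' : x 0 = y 0 := h2 0 (by simp; omega) (by simp)
      obtain ⟨i, rfl⟩ : ∃ i', i = i' + 1 := ⟨i - 1, by omega⟩
      rw [h0', hF.mid i (by omega) e he (Fin.tail x) (Fin.tail y) h0 h1
        (fun j hj hj' => h2 j.succ (by simp; omega) (by simp; omega))]

theorem isBimoduleMap_mulRightTerm {n : ℕ} {F : MultilinearMap k (fun _ : Fin n => rad k A) A}
    (hF : D.IsBimoduleMap F) : D.IsBimoduleMap (mulRightTerm (rad k A).subtype F) := by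
  have hm : ∀ x : Fin (n + 1) → rad k A,
      mulRightTerm (rad k A).subtype F x = F (Fin.init x) * x (Fin.last n) := fun _ => rfl
  refine ⟨fun h => by omega, ?_, ?_, ?_⟩
  · intro h e he x y h0 h1
    rw [hm, hm]
    rcases Nat.eq_zero_or_pos n with rfl | hn
    · have h0' : (y (Fin.last 0) : A) = e * x (Fin.last 0) := h0
      rw [h0', ← mul_assoc, ← hF.zero rfl e he, mul_assoc,
        Subsingleton.elim (Fin.init y) (Fin.init x)]
    · have h0' : y (Fin.last n) = x (Fin.last n) := h1 _ (by simp; omega)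
      rw [h0', ← mul_assoc, ← hF.left hn e he (Fin.init x) (Fin.init y) h0
        (fun j hj => h1 j.castSucc hj)]
  · intro h e he x y h0 h1
    have h0' : (y (Fin.last n) : A) = x (Fin.last n) * e := h0
    have h1' : Fin.init y = Fin.init x := funext fun j => h1 j.castSucc (by simp; omega)
    rw [hm, hm, h0', h1', mul_assoc]
  · intro i h e he x y h0 h1 h2
    rw [hm, hm]
    by_cases hi : i + 1 = n
    · subst hi
      have h1' : (y (Fin.last (i + 1)) : A) = e * x (Fin.last (i + 1)) := h1
      rw [h1', ← mul_assoc, ← hF.right (by omega) e he (Fin.init y) (Fin.init x) h0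
        (fun j hj => h2 j.castSucc hj (by have := j.2; simp; omega))]
    · have h0' : x (Fin.last n) = y (Fin.last n) := h2 _ (by simp; omega) (by simp; omega)
      rw [h0', hF.mid i (by omega) e he (Fin.init x) (Fin.init y) h0 h1
        (fun j hj hj' => h2 j.castSucc hj hj')]

theorem add_proj_mem (a : A) : ∃ u ∈ D.E, u + D.proj a = a := by
  have h := Submodule.projection_add_projection_eq_self D.isCompl a
  exact ⟨_, ((Subalgebra.toSubmodule D.E).projectionOnto _ D.isCompl a).2, h⟩

theorem proj_of_mem {e : A} (he : e ∈ D.E) : D.proj e = 0 :=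
  (Submodule.projectionOnto_apply_eq_zero_iff D.isCompl.symm).2 he

theorem proj_of_mem_rad {x : A} (hx : x ∈ rad k A) : (D.proj x : A) = x :=
  congrArg Subtype.val (Submodule.projectionOnto_apply_left D.isCompl.symm ⟨x, hx⟩)

theorem proj_mul_left {e : A} (he : e ∈ D.E) (a : A) : (D.proj (e * a) : A) = e * D.proj a := by
  obtain ⟨u, hu, h⟩ := D.add_proj_mem a
  conv_lhs => rw [← h]
  rw [mul_add, map_add, proj_of_mem (D.E.mul_mem he hu), zero_add,
    proj_of_mem_rad (mul_mem_rad_left e (D.proj a).2)]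

theorem proj_mul_right {e : A} (he : e ∈ D.E) (a : A) : (D.proj (a * e) : A) = D.proj a * e := by
  obtain ⟨u, hu, h⟩ := D.add_proj_mem a
  conv_lhs => rw [← h]
  rw [add_mul, map_add, proj_of_mem (D.E.mul_mem hu he), zero_add,
    proj_of_mem_rad (mul_mem_rad_right e (D.proj a).2)]

theorem isBimoduleMap_proj {n : ℕ} {F : (Fin (n + 1) → rad k A) → A} (hF : D.IsBimoduleMap F) :
    D.IsBimoduleMap (fun x => (D.proj (F x) : A)) where
  zero h := by omega
  left h e he x y h0 h1 := by rw [hF.left h e he x y h0 h1, proj_mul_left he]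
  right h e he x y h0 h1 := by rw [hF.right h e he x y h0 h1, proj_mul_right he]
  mid i h e he x y h0 h1 h2 := by rw [hF.mid i h e he x y h0 h1 h2]

variable (D)

/-- The differential of the reduced complex. -/
def reducedDiff (n : ℕ) : D.reducedCochain n →ₗ[k] D.reducedCochain (n + 1) :=
  ((differential (rad k A).subtype (radMul k A) n).domRestrict (D.reducedCochain n)).codRestrict
    (D.reducedCochain (n + 1)) fun f =>
      add_mem (add_mem (isBimoduleMap_mulLeftTerm f.2) (sum_mem fun i _ =>
        Submodule.smul_mem _ _ (isBimoduleMap_insertAt _ i f.2 isBimoduleMap_radMul)))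
        (Submodule.smul_mem _ _ (isBimoduleMap_mulRightTerm f.2))

theorem preLie_mem {p q r : ℕ} (h : p + q = r) (f : D.reducedCochain (p + 1))
    (g : D.reducedCochain (q + 1)) :
    preLie D.proj h f.1 g.1 ∈ D.reducedCochain (r + 1) :=
  sum_mem fun i _ => Submodule.smul_mem _ _
    (isBimoduleMap_insertAt _ i f.2 (isBimoduleMap_proj g.2))

/-- The reduced bracket `[f, g]_R` on `C^{*+1}_E(r, A)`; degree `p` is `C^{p+1}_E(r, A)`. -/
def reducedBracket {p q r : ℕ} (h : p + q = r) :
    D.reducedCochain (p + 1) →ₗ[k] D.reducedCochain (q + 1) →ₗ[k] D.reducedCochain (r + 1) :=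
  LinearMap.mk₂ k
    (fun f g => ⟨gradedCommutator D.proj h f.1 g.1,
      sub_mem (D.preLie_mem h f g) (Submodule.smul_mem _ _ (D.preLie_mem _ g f))⟩)
    (fun f f' g => Subtype.ext (by simp)) (fun c f g => Subtype.ext (by simp))
    (fun f g g' => Subtype.ext (by simp)) (fun c f g => Subtype.ext (by simp))

theorem reducedBracket_coe {p q r : ℕ} (h : p + q = r) (f : D.reducedCochain (p + 1))
    (g : D.reducedCochain (q + 1)) :
    (D.reducedBracket h f g).1 = gradedCommutator D.proj h f.1 g.1 := rfl

/-- The cocycles of degree `p + 1` of the reduced complex. -/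
abbrev ReducedCocycle (p : ℕ) : Submodule k (D.reducedCochain (p + 1)) :=
  Cocycle (C := fun n => D.reducedCochain n) D.reducedDiff p

/-- The Hochschild cohomology `HH^{p+1}(A)` computed by the reduced complex. -/
abbrev ReducedHH (p : ℕ) : Type _ :=
  CohomologySucc (C := fun n => D.reducedCochain n) D.reducedDiff p

/-- The class of a cocycle of the reduced complex. -/
abbrev reducedClass (p : ℕ) : D.ReducedCocycle p →ₗ[k] D.ReducedHH p :=
  cohomologyClass (C := fun n => D.reducedCochain n) D.reducedDiff p

/-! ### The comparison maps -/

/-- The map `pⁿ : C^n_E(r, A) → Cⁿ(A, A)`, `pⁿf(x₁, …, x_n) = f(π x₁, …, π x_n)`. -/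
def pMap (n : ℕ) : D.reducedCochain n →ₗ[k] HochschildCochain k A n where
  toFun f := f.1.compLinearMap fun _ => D.proj
  map_add' _ _ := rfl
  map_smul' _ _ := rfl

/-- The linear map `r → A`, `x ↦ e_a x e_b`. -/
def corner (a b : Fin N) : rad k A →ₗ[k] A :=
  LinearMap.mulLeft k (D.idem a) ∘ₗ LinearMap.mulRight k (D.idem b) ∘ₗ (rad k A).subtype

/-- The formula for `sⁿ`:
`sⁿf(x₁, …, x_n) = ∑ e_{j₀} f(e_{j₀} x₁ e_{j₁}, …, e_{j_{n-1}} x_n e_{j_n}) e_{j_n}`,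
the sum being over all tuples `(j₀, …, j_n)`. -/
def sFormula {n : ℕ} (f : HochschildCochain k A n) :
    MultilinearMap k (fun _ : Fin n => rad k A) A :=
  ∑ j : Fin (n + 1) → Fin N,
    (LinearMap.mulLeft k (D.idem (j 0)) ∘ₗ
      LinearMap.mulRight k (D.idem (j (Fin.last n)))).compMultilinearMap
        (f.compLinearMap fun i => D.corner (j i.castSucc) (j i.succ))

theorem sFormula_apply {n : ℕ} (f : HochschildCochain k A n) (x : Fin n → rad k A) :
    D.sFormula f x = ∑ j : Fin (n + 1) → Fin N, D.idem (j 0) *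
      (f (fun i => D.idem (j i.castSucc) * (x i * D.idem (j i.succ))) *
        D.idem (j (Fin.last n))) := by
  simp [sFormula, corner]

variable {D} in
/-- An element of `E` acts on each idempotent as a scalar. -/
theorem exists_scalar {e : A} (he : e ∈ D.E) : ∃ c : Fin N → k, ∀ j,
    e * D.idem j = c j • D.idem j ∧ D.idem j * e = c j • D.idem j := by
  refine ⟨D.equiv ⟨e, he⟩, fun j => ?_⟩
  have h1 : (⟨e, he⟩ : D.E) * D.equiv.symm (Pi.single j 1)
      = D.equiv ⟨e, he⟩ j • D.equiv.symm (Pi.single j 1) := by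
    apply D.equiv.injective
    ext l
    by_cases hl : l = j
    · subst hl; simp
    · simp [hl]
  have h2 : D.equiv.symm (Pi.single j 1) * (⟨e, he⟩ : D.E)
      = D.equiv ⟨e, he⟩ j • D.equiv.symm (Pi.single j 1) := by
    apply D.equiv.injective
    ext l
    by_cases hl : l = j
    · subst hl; simp
    · simp [hl]
  exact ⟨congrArg Subtype.val h1, congrArg Subtype.val h2⟩

theorem sFormula_mem {n : ℕ} (f : HochschildCochain k A n) :
    D.sFormula f ∈ D.reducedCochain n := by
  have scale : ∀ (c : k) (i : Fin n) (u v : Fin n → A), u i = c • v i →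
      (∀ l, l ≠ i → u l = v l) → f u = c • f v := by
    intro c i u v h0 h1
    have : u = Function.update v i (c • v i) := by
      funext l
      by_cases hl : l = i
      · subst hl; simp [h0]
      · simp [hl, h1 l hl]
    rw [this, MultilinearMap.map_update_smul, Function.update_eq_self]
  refine ⟨?_, ?_, ?_, ?_⟩
  · intro h e he x
    subst h
    obtain ⟨c, hc⟩ := exists_scalar he
    rw [sFormula_apply, Finset.mul_sum, Finset.sum_mul]
    refine Finset.sum_congr rfl fun j _ => ?_
    have : j (Fin.last 0) = j 0 := rfl
    rw [← mul_assoc, (hc _).1, mul_assoc, mul_assoc, this, (hc _).2]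
    simp
  · intro h e he x y h0 h1
    obtain ⟨c, hc⟩ := exists_scalar he
    rw [sFormula_apply, sFormula_apply, Finset.mul_sum]
    refine Finset.sum_congr rfl fun j _ => ?_
    rw [scale (c (j 0)) ⟨0, h⟩ _ (fun i => D.idem (j i.castSucc) * (x i * D.idem (j i.succ)))
      ?_ ?_]
    · rw [← mul_assoc e, (hc _).1]
      simp
    · have : (⟨0, h⟩ : Fin n).castSucc = 0 := rfl
      rw [h0, this, mul_assoc e, ← mul_assoc (D.idem (j 0)), (hc _).2, smul_mul_assoc]
    · intro l hl
      rw [h1 l (fun h' => hl (Fin.ext h'))]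
  · intro h e he x y h0 h1
    obtain ⟨c, hc⟩ := exists_scalar he
    rw [sFormula_apply, sFormula_apply, Finset.sum_mul]
    refine Finset.sum_congr rfl fun j _ => ?_
    rw [scale (c (j (Fin.last n))) ⟨n - 1, by omega⟩ _
      (fun i => D.idem (j i.castSucc) * (x i * D.idem (j i.succ))) ?_ ?_]
    · rw [mul_assoc, mul_assoc, (hc _).2]
      simp
    · have : (⟨n - 1, by omega⟩ : Fin n).succ = Fin.last n := Fin.ext (by simp; omega)
      rw [h0, this, mul_assoc _ e, (hc _).1, mul_smul_comm, mul_smul_comm]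
    · intro l hl
      rw [h1 l (fun h' => hl (Fin.ext h'))]
  · intro i h e he x y h0 h1 h2
    obtain ⟨c, hc⟩ := exists_scalar he
    rw [sFormula_apply, sFormula_apply]
    refine Finset.sum_congr rfl fun j _ => ?_
    set a : Fin n := ⟨i, by omega⟩ with ha
    set b : Fin n := ⟨i + 1, h⟩ with hb
    have hab : a ≠ b := fun h' => by simp [ha, hb] at h'
    set z : Fin n → rad k A := Function.update x a (y a) with hz
    have hza : z a = y a := by simp [hz]
    have hzx : ∀ l, l ≠ a → z l = x l := fun l hl => by simp [hz, hl]
    have hzy : ∀ l, l ≠ b → z l = y l := fun l hl => by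
      by_cases hl' : l = a
      · rw [hl', hza]
      · rw [hzx l hl']
        exact h2 l (fun h' => hl' (Fin.ext h')) (fun h' => hl (Fin.ext h'))
    rw [scale (c (j a.succ)) a (fun i => D.idem (j i.castSucc) * (x i * D.idem (j i.succ)))
      (fun i => D.idem (j i.castSucc) * (z i * D.idem (j i.succ))) ?_ ?_,
      scale (c (j a.succ)) b (fun i => D.idem (j i.castSucc) * (y i * D.idem (j i.succ)))
      (fun i => D.idem (j i.castSucc) * (z i * D.idem (j i.succ))) ?_ ?_]
    · have : b.castSucc = a.succ := rfl
      rw [h1, this, hzx b hab.symm, mul_assoc e, ← mul_assoc (D.idem (j a.succ)), (hc _).2,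
        smul_mul_assoc]
    · intro l hl
      rw [hzy l hl]
    · rw [h0, hza, mul_assoc _ e, (hc _).1, mul_smul_comm, mul_smul_comm]
    · intro l hl
      rw [hzx l hl]

/-- The map `sⁿ : Cⁿ(A, A) → C^n_E(r, A)`. -/
def sMap (n : ℕ) : HochschildCochain k A n →ₗ[k] D.reducedCochain n where
  toFun f := ⟨D.sFormula f, D.sFormula_mem f⟩
  map_add' f g := Subtype.ext (by
    ext x
    simp [sFormula_apply, mul_add, add_mul, Finset.sum_add_distrib])
  map_smul' c f := Subtype.ext (by
    ext x
    simp [sFormula_apply, Finset.smul_sum])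

end RadicalSplitting

end Reduced

end ReducedBracket

end

/-! The map p embeds the reduced complex into the Hochschild complex: evaluating p f on elements of
r gives f back. The π placed between the two cochains in the reduced bracket is exactly the π that p
f applies to its arguments, so p carries the reduced bracket to the Gerstenhaber bracket
(`pMap_reducedBracket`); p also commutes with δ (`pMap_reducedDiff`). Every cochain identity for the
reduced bracket is therefore pulled back along an injective map, and s p = id (`sMap_pMap`) yields
[f,g]_R = s[pf,pg].

On the Hochschild side, the associator of ∘ is a sum over pairs of disjoint insertions, hence
symmetric up to sign (`preLie_associator`). This is the graded pre-Lie identity, and three instances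
of it add up to Jacobi. Since [f, μ] = -δf for the multiplication μ (`gerstenhaberBracket_mul`), the
Leibniz rule is Jacobi with μ as third entry. It makes the bracket descend to cohomology, except
against coboundaries of elements a of A: these have degree -1 and lie outside the bracket, so an
explicit primitive is needed, which inserts a into every slot
(`gerstenhaberBracket_hochschildDiff_zero`).

That p is bijective on cohomology is normalization relative to the separable algebra E. Computations
use the bar form x₀ f(x₁,…,x_n) x_{n+1}, in which δ is the alternating sum of products of
neighbours. If f and δf both vanish as soon as one argument lies in E, then f is balanced over E and
comes from a reduced cochain (`exists_pMap_eq`). If only δf is normalized, f is made normalized one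
argument at a time, by coboundaries built from replacing X_i by the pair X_i e_a, e_a and summing
over a, with ∑ e_a = 1 (`exists_homotopy`, `exists_vanishesUpTo_succ`). With δf = 0 this gives
surjectivity; applied to g when p f = δg, it gives injectivity. -/

noncomputable section

namespace ReducedBracket

/-! ### Multilinear maps evaluated on sequences -/

section Sequences

variable {k V W : Type*} [Field k] [AddCommGroup V] [Module k V] [AddCommGroup W] [Module k W]

/-- The value of a multilinear map on the first terms of a sequence. -/
def ev {n : ℕ} (f : MultilinearMap k (fun _ : Fin n => V) W) (X : ℕ → V) : W :=
  f fun i => X i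

/-- Sequences indexed by ℕ turn all index shifts into plain arithmetic. Nothing is lost, since a
finite tuple extends by zero to a sequence. -/
theorem ev_ext {n : ℕ} {f g : MultilinearMap k (fun _ : Fin n => V) W}
    (h : ∀ X, ev f X = ev g X) : f = g := by
  ext x
  have := h fun j => if hj : j < n then x ⟨j, hj⟩ else 0
  simpa [ev] using this

theorem ev_congr {n : ℕ} (f : MultilinearMap k (fun _ : Fin n => V) W) {X Y : ℕ → V}
    (h : ∀ j < n, X j = Y j) : ev f X = ev f Y :=
  congrArg f (funext fun i => h i i.2)

theorem ev_add {n : ℕ} (f g : MultilinearMap k (fun _ : Fin n => V) W) (X : ℕ → V) :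
    ev (f + g) X = ev f X + ev g X := rfl

theorem ev_sub {n : ℕ} (f g : MultilinearMap k (fun _ : Fin n => V) W) (X : ℕ → V) :
    ev (f - g) X = ev f X - ev g X := rfl

theorem ev_smul {n : ℕ} (c : k) (f : MultilinearMap k (fun _ : Fin n => V) W) (X : ℕ → V) :
    ev (c • f) X = c • ev f X := rfl

theorem ev_sum {n : ℕ} {ι : Type*} (s : Finset ι)
    (f : ι → MultilinearMap k (fun _ : Fin n => V) W) (X : ℕ → V) :
    ev (∑ i ∈ s, f i) X = ∑ i ∈ s, ev (f i) X := by
  simp [ev]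

theorem ev_update {n : ℕ} (f : MultilinearMap k (fun _ : Fin n => V) W) (X : ℕ → V) {j : ℕ}
    (hj : j < n) (v : V) :
    ev f (Function.update X j v) = f.toLinearMap (fun i => X i) ⟨j, hj⟩ v := by
  simp only [ev, MultilinearMap.toLinearMap_apply]
  congr 1
  funext i
  simp only [Function.update_apply, Fin.ext_iff]

/-- The sequence `(X₀, …, X_{i-1}, v, X_{i+q+1}, …)`. -/
def replaceBlock (i q : ℕ) (v : V) (X : ℕ → V) : ℕ → V := fun j =>
  if j < i then X j else if j = i then v else X (j + q)

/-- Exhibits the dependence on the inserted value v as a linear map, so that sums and scalars can be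
pulled out of a slot. The placeholder 0 is irrelevant: that slot is overwritten. -/
theorem ev_replaceBlock {n : ℕ} (f : MultilinearMap k (fun _ : Fin n => V) W) (X : ℕ → V)
    {i : ℕ} (q : ℕ) (hi : i < n) (v : V) :
    ev f (replaceBlock i q v X) =
      f.toLinearMap (fun j => replaceBlock i q 0 X j) ⟨i, hi⟩ v := by
  rw [← ev_update]
  congr 1
  funext j
  simp only [replaceBlock, Function.update_apply]
  split_ifs <;> first | rfl | omega

theorem ev_insertAt {n q N : ℕ} (h : n + q = N) (i : Fin n)
    (F : MultilinearMap k (fun _ : Fin n => V) W)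
    (G : MultilinearMap k (fun _ : Fin (q + 1) => V) V) (X : ℕ → V) :
    ev (insertAt h i F G) X = ev F (replaceBlock i q (ev G fun l => X (i + l)) X) := by
  simp only [ev, insertAt_apply]
  congr 1
  funext j
  simp only [insertArgs, replaceBlock, Fin.lt_def, Fin.ext_iff]

end Sequences

/-! ### The pre-Lie identity and the Jacobi identity -/

section PreLie

variable {k A : Type*} [Field k] [Ring A] [Algebra k A]

theorem ev_preLie_proj {V : Type*} [AddCommGroup V] [Module k V] (π : A →ₗ[k] V) {p q r : ℕ}
    (h : p + q = r) (f : MultilinearMap k (fun _ : Fin (p + 1) => V) A)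
    (g : MultilinearMap k (fun _ : Fin (q + 1) => V) A) (X : ℕ → V) :
    ev (preLie π h f g) X = ∑ i ∈ Finset.range (p + 1), (-1 : k) ^ (i * q) •
      ev f (replaceBlock i q (π (ev g fun l => X (i + l))) X) := by
  rw [preLie, ev_sum, Finset.sum_range]
  refine Finset.sum_congr rfl fun i _ => ?_
  rw [ev_smul, ev_insertAt]
  rfl

theorem ev_preLie {p q r : ℕ} (h : p + q = r) (f : HochschildCochain k A (p + 1))
    (g : HochschildCochain k A (q + 1)) (X : ℕ → A) :
    ev (preLie LinearMap.id h f g) X = ∑ i ∈ Finset.range (p + 1), (-1 : k) ^ (i * q) •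
      ev f (replaceBlock i q (ev g fun l => X (i + l)) X) := by
  rw [ev_preLie_proj]
  rfl

/-- The arguments `(…, g(X_i, …), …, h(X_{j+q}, …), …)` of `f`, for `i < j`. -/
def replaceTwoBlocks {q r : ℕ} (g : HochschildCochain k A (q + 1))
    (h : HochschildCochain k A (r + 1)) (i j : ℕ) (X : ℕ → A) : ℕ → A := fun t =>
  if t < i then X t else if t = i then ev g fun l => X (i + l)
  else if t < j then X (t + q) else if t = j then ev h fun l => X (j + q + l)
  else X (t + q + r)

/-- The brace `f{g, h}` with its signs. -/
def brace {p q r : ℕ} (f : HochschildCochain k A (p + 1)) (g : HochschildCochain k A (q + 1))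
    (h : HochschildCochain k A (r + 1)) (X : ℕ → A) : A :=
  ∑ j ∈ Finset.range (p + 1), ∑ i ∈ Finset.range j, (-1 : k) ^ (i * q + j * r) •
    ev f (replaceTwoBlocks g h i j X)

/-- The three ranges are the positions before, inside and after a block of length q + 1 starting at
i. -/
theorem sum_range_split {M : Type*} [AddCommMonoid M] (a : ℕ → M) {p i : ℕ} (q : ℕ)
    (hi : i < p + 1) :
    ∑ j ∈ Finset.range (p + q + 1), a j = ∑ j ∈ Finset.range i, a j
      + ∑ l ∈ Finset.range (q + 1), a (i + l) + ∑ j ∈ Finset.Ico (i + 1) (p + 1), a (j + q) := by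
  rw [← Finset.sum_range_add_sum_Ico a (by omega : i ≤ p + q + 1),
    ← Finset.sum_Ico_consecutive a (by omega : i ≤ i + q + 1) (by omega), ← add_assoc,
    Finset.sum_Ico_eq_sum_range a i (i + q + 1), Finset.sum_Ico_add' a (i + 1) (p + 1) q]
  congr 3 <;> [congr 1; skip; skip] <;> omega

/-- In (f ∘ g) ∘ h, the cochain h lands either inside g, which gives f ∘ (g ∘ h), or in a slot of f
to the left or right of g, which gives the two braces. To the right of g its position is shifted by
q, whence the factor (-1)^{qr}. -/
theorem preLie_associator {p q r pq qr s : ℕ} (hpq : p + q = pq) (hqr : q + r = qr)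
    (h₁ : pq + r = s) (h₂ : p + qr = s) (f : HochschildCochain k A (p + 1))
    (g : HochschildCochain k A (q + 1)) (h : HochschildCochain k A (r + 1)) (X : ℕ → A) :
    ev (preLie LinearMap.id h₁ (preLie LinearMap.id hpq f g) h) X =
      ev (preLie LinearMap.id h₂ f (preLie LinearMap.id hqr g h)) X
        + (brace f h g X + (-1 : k) ^ (q * r) • brace f g h X) := by
  subst hpq hqr
  have e1 : ev (preLie LinearMap.id h₁ (preLie LinearMap.id rfl f g) h) X
      = ∑ i ∈ Finset.range (p + 1), ∑ j ∈ Finset.range (p + q + 1), (-1 : k) ^ (j * r + i * q) •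
        ev f (replaceBlock i q
          (ev g fun l => replaceBlock j r (ev h fun l => X (j + l)) X (i + l))
            (replaceBlock j r (ev h fun l => X (j + l)) X)) := by
    rw [ev_preLie, Finset.sum_comm]
    simp only [ev_preLie, Finset.smul_sum, smul_smul, pow_add]
  have e2 : ev (preLie LinearMap.id h₂ f (preLie LinearMap.id rfl g h)) X
      = ∑ i ∈ Finset.range (p + 1), ∑ l ∈ Finset.range (q + 1),
        (-1 : k) ^ (i * (q + r) + l * r) •
        ev f (replaceBlock i (q + r) (ev g (replaceBlock l r
          (ev h fun t => X (i + (l + t))) fun t => X (i + t))) X) := by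
    rw [ev_preLie]
    -- The inner sum g ∘ h sits in one slot of f and leaves it by linearity in that slot.
    refine Finset.sum_congr rfl fun i hi => ?_
    rw [ev_preLie, ev_replaceBlock _ _ _ (Finset.mem_range.1 hi), map_sum, Finset.smul_sum]
    refine Finset.sum_congr rfl fun l _ => ?_
    rw [map_smul, ← ev_replaceBlock, smul_smul, pow_add]
  have e3 : brace f g h X = ∑ i ∈ Finset.range (p + 1), ∑ j ∈ Finset.Ico (i + 1) (p + 1),
      (-1 : k) ^ (i * q + j * r) • ev f (replaceTwoBlocks g h i j X) := by
    rw [brace]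
    refine Finset.sum_comm' fun j i => ?_
    simp only [Finset.mem_range, Finset.mem_Ico]
    omega
  rw [e1, e2, e3, brace, Finset.smul_sum, ← Finset.sum_add_distrib, ← Finset.sum_add_distrib]
  refine Finset.sum_congr rfl fun i hi => ?_
  -- With the slot i of g fixed, the position j of h is split into left of, inside and right of the
  -- block of g.
  rw [sum_range_split (M := A) _ q (Finset.mem_range.1 hi), add_comm (∑ j ∈ Finset.range i, _), add_assoc,
    Finset.smul_sum]
  congr 1
  · refine Finset.sum_congr rfl fun l hl => ?_
    rw [Finset.mem_range] at hl
    congr 1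
    · ring
    · congr 1
      funext t
      simp only [replaceBlock]
      split_ifs <;> first | omega | rfl | skip
      · refine ev_congr g fun u hu => ?_
        simp only [replaceBlock]
        split_ifs <;> first | omega | rfl | simp only [add_assoc]
      · exact congrArg X (add_assoc _ _ _)
  congr 1
  · refine Finset.sum_congr rfl fun j hj => ?_
    rw [Finset.mem_range] at hj
    congr 1
    congr 1
    funext t
    simp only [replaceBlock, replaceTwoBlocks]
    split_ifs <;> first | omega | rfl | skip
    · refine ev_congr g fun u hu => ?_
      split_ifs <;> first | omega | skip
      congr 1
      omega
    · congr 1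
      omega
  · refine Finset.sum_congr rfl fun j hj => ?_
    rw [Finset.mem_Ico] at hj
    rw [smul_smul, ← pow_add]
    congr 1
    · ring
    congr 1
    funext t
    simp only [replaceBlock, replaceTwoBlocks]
    split_ifs <;> first | omega | rfl | skip
    refine ev_congr g fun u hu => ?_
    split_ifs <;> first | omega | rfl

theorem neg_one_pow_mul_self (n : ℕ) : (-1 : k) ^ n * (-1 : k) ^ n = 1 := by
  rw [← mul_pow]; simp

/-- The graded pre-Lie identity. -/
theorem preLie_preLie {p q r pq qr pr s : ℕ} (hpq : p + q = pq) (hqr : q + r = qr)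
    (hrq : r + q = qr) (hpr : p + r = pr) (h₁ : pq + r = s) (h₂ : p + qr = s) (h₃ : pr + q = s)
    (f : HochschildCochain k A (p + 1)) (g : HochschildCochain k A (q + 1))
    (h : HochschildCochain k A (r + 1)) :
    preLie LinearMap.id h₁ (preLie LinearMap.id hpq f g) h
        - preLie LinearMap.id h₂ f (preLie LinearMap.id hqr g h) = (-1 : k) ^ (q * r) •
      (preLie LinearMap.id h₃ (preLie LinearMap.id hpr f h) g
        - preLie LinearMap.id h₂ f (preLie LinearMap.id hrq h g)) := by
  refine ev_ext fun X => ?_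
  rw [ev_smul, ev_sub, ev_sub, preLie_associator hpq hqr h₁ h₂, preLie_associator hpr hrq h₃ h₂,
    add_sub_cancel_left, add_sub_cancel_left, smul_add, smul_smul, mul_comm r q,
    neg_one_pow_mul_self, one_smul, add_comm]

theorem gerstenhaberBracket_apply {p q r : ℕ} (h : p + q = r) (h' : q + p = r)
    (f : HochschildCochain k A (p + 1)) (g : HochschildCochain k A (q + 1)) :
    gerstenhaberBracket k A h f g =
      preLie LinearMap.id h f g - (-1 : k) ^ (p * q) • preLie LinearMap.id h' g f := rfl

theorem gerstenhaberBracket_isGradedLieBracket :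
    IsGradedLieBracket (k := k) (L := fun p => HochschildCochain k A (p + 1))
      (fun {_ _ _} h => gerstenhaberBracket k A h) where
  antisymm {p q s} h h' f g := by
    rw [gerstenhaberBracket_apply h h', gerstenhaberBracket_apply h' h, smul_sub, smul_smul,
      mul_comm q p, neg_one_pow_mul_self, one_smul]
    abel
  jacobi {p q r qr rp pq s} hqr hrp hpq h₁ h₂ h₃ f g h := by
    have hrq : r + q = qr := by omega
    have hpr : p + r = rp := by omega
    have hqp : q + p = pq := by omega
    have h₁' : qr + p = s := by omega
    have h₂' : rp + q = s := by omega
    have h₃' : pq + r = s := by omega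
    have R1 := preLie_preLie hpq hqr hrq hpr h₃' h₁ h₂' f g h
    have R2 := preLie_preLie hqr hrp hpr hqp h₁' h₂ h₃' g h f
    have R3 := preLie_preLie hrp hpq hqp hrq h₂' h₃ h₁' h f g
    have b := fun (a c d : ℕ) (e : a + c = d) => preLie_bilin (LinearMap.id : A →ₗ[k] A) e
    rw [gerstenhaberBracket_apply h₁ h₁', gerstenhaberBracket_apply h₂ h₂',
      gerstenhaberBracket_apply h₃ h₃', gerstenhaberBracket_apply hqr hrq,
      gerstenhaberBracket_apply hrp hpr, gerstenhaberBracket_apply hpq hqp]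
    subst hqr hrp hpq
    have l1 : ∀ {a c d : ℕ} (e : a + c = d) (x : HochschildCochain k A (a + 1)) (t : k)
      (y z : HochschildCochain k A (c + 1)), preLie LinearMap.id e x (y - t • z)
        = preLie LinearMap.id e x y - t • preLie LinearMap.id e x z := fun e x t y z => by
      rw [sub_eq_add_neg, ← neg_smul t z, (b _ _ _ e).2.2.1, (b _ _ _ e).2.2.2]
      module
    have l2 : ∀ {a c d : ℕ} (e : a + c = d) (x : HochschildCochain k A (c + 1)) (t : k)
      (y z : HochschildCochain k A (a + 1)), preLie LinearMap.id e (y - t • z) x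
        = preLie LinearMap.id e y x - t • preLie LinearMap.id e z x := fun e x t y z => by
      rw [sub_eq_add_neg, ← neg_smul t z, (b _ _ _ e).1, (b _ _ _ e).2.1]
      module
    simp only [l1, l2, mul_add, pow_add, mul_comm q p, mul_comm r p, mul_comm r q] at R1 R2 R3 ⊢
    -- Only the parities of pq, pr, qr matter. Jacobi is the combination of R1, R2, R3 with
    -- coefficients -(-1)^{pr}, -(-1)^{pq}, -(-1)^{qr}.
    rcases neg_one_pow_eq_or k (p * q) with ha | ha <;>
    rcases neg_one_pow_eq_or k (p * r) with hb | hb <;>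
    rcases neg_one_pow_eq_or k (q * r) with hc | hc <;>
    simp only [ha, hb, hc] at R1 R2 R3 ⊢
    · linear_combination (norm := module) (-1 : k) • R1 - R2 - R3
    · linear_combination (norm := module) (-1 : k) • R1 - R2 + R3
    · linear_combination (norm := module) (1 : k) • R1 - R2 - R3
    · linear_combination (norm := module) (1 : k) • R1 - R2 + R3
    · linear_combination (norm := module) (-1 : k) • R1 + R2 - R3
    · linear_combination (norm := module) (-1 : k) • R1 + R2 + R3
    · linear_combination (norm := module) (1 : k) • R1 + R2 - R3
    · linear_combination (norm := module) (1 : k) • R1 + R2 + R3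

end PreLie

end ReducedBracket

end

noncomputable section

namespace ReducedBracket

/-! ### The bar form of the differential -/

section Bar

variable {k A : Type*} [Field k] [Ring A] [Algebra k A]

/-- The map `(x₀, …, x_{n+1}) ↦ x₀ f(x₁, …, x_n) x_{n+1}`. -/
def bar {n : ℕ} (f : HochschildCochain k A n) : HochschildCochain k A (n + 1 + 1) :=
  mulRightTerm LinearMap.id (mulLeftTerm LinearMap.id f)

theorem ev_bar {n : ℕ} (f : HochschildCochain k A n) (X : ℕ → A) :
    ev (bar f) X = X 0 * (ev f fun j => X (j + 1)) * X (n + 1) := rfl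

theorem ev_bar_zero {n : ℕ} (X : ℕ → A) : ev (bar (0 : HochschildCochain k A n)) X = 0 := by
  rw [ev_bar]
  simp [ev]

theorem bar_smul {n : ℕ} (c : k) (f : HochschildCochain k A n) : bar (c • f) = c • bar f :=
  ev_ext fun X => by simp [ev_bar, ev_smul]

theorem bar_sub {n : ℕ} (f g : HochschildCochain k A n) : bar (f - g) = bar f - bar g :=
  ev_ext fun X => by simp [ev_bar, ev_sub, mul_sub, sub_mul]

theorem ev_bar_sum {n : ℕ} {ι : Type*} (s : Finset ι) (f : ι → HochschildCochain k A n)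
    (X : ℕ → A) : ev (bar (∑ i ∈ s, f i)) X = ∑ i ∈ s, ev (bar (f i)) X := by
  simp only [ev_bar, ev_sum, Finset.mul_sum, Finset.sum_mul]

/-- The sequence `(1, X₀, …, X_{n-1}, 1, …)`. -/
def padOne (n : ℕ) (X : ℕ → A) : ℕ → A := fun j =>
  if j = 0 then 1 else if j = n + 1 then 1 else X (j - 1)

/-- Outer entries equal to 1 recover f, so passing to the bar form loses nothing. -/
theorem ev_bar_padOne {n : ℕ} (f : HochschildCochain k A n) (X : ℕ → A) :
    ev (bar f) (padOne n X) = ev f X := by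
  have e0 : padOne n X 0 = 1 := rfl
  have e1 : padOne n X (n + 1) = 1 := by simp [padOne]
  rw [ev_bar, e0, e1, one_mul, mul_one]
  refine ev_congr f fun j hj => ?_
  rw [padOne, if_neg (by omega), if_neg (by omega), Nat.add_sub_cancel]

theorem bar_injective {n : ℕ} {f g : HochschildCochain k A n}
    (h : ∀ X, ev (bar f) X = ev (bar g) X) : f = g :=
  ev_ext fun X => by rw [← ev_bar_padOne f, ← ev_bar_padOne g, h]

/-- The sequence `(X₀, …, X_l X_{l+1}, …)`. -/
def merge (l : ℕ) (X : ℕ → A) : ℕ → A := replaceBlock l 1 (X l * X (l + 1)) X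

theorem merge_apply (l : ℕ) (X : ℕ → A) (j : ℕ) : merge l X j =
    if j < l then X j else if j = l then X l * X (l + 1) else X (j + 1) := rfl

/-- The simplicial identity for the faces; the case m = l is associativity of A. -/
theorem merge_merge {l m : ℕ} (h : m ≤ l) (X : ℕ → A) :
    merge m (merge (l + 1) X) = merge l (merge m X) := by
  funext j
  simp only [merge_apply]
  split_ifs <;> first | omega | rfl | skip
  · subst_vars; simp [mul_assoc]

theorem ev_differential {V : Type*} [AddCommGroup V] [Module k V] (ι : V →ₗ[k] A)
    (m : V →ₗ[k] V →ₗ[k] V) {n : ℕ} (f : MultilinearMap k (fun _ : Fin n => V) A) (X : ℕ → V) :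
    ev (differential ι m n f) X = (ι (X 0) * ev f fun j => X (j + 1))
      + ∑ i ∈ Finset.range n, (-1 : k) ^ (i + 1) •
        ev f (replaceBlock i 1 (m (X i) (X (i + 1))) X)
      + (-1 : k) ^ (n + 1) • (ev f X * ι (X n)) := by
  have h : differential ι m n f = mulLeftTerm ι f
    + ∑ i : Fin n, (-1 : k) ^ (i.val + 1) • insertAt (q := 1) rfl i f (bilinTwo m)
    + (-1 : k) ^ (n + 1) • mulRightTerm ι f := rfl
  rw [h, ev_add, ev_add, ev_sum, Finset.sum_range]
  congr 2
  refine Finset.sum_congr rfl fun i _ => ?_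
  rw [ev_smul, ev_insertAt]
  rfl

theorem ev_hochschildDiff {n : ℕ} (f : HochschildCochain k A n) (X : ℕ → A) :
    ev (hochschildDiff k A n f) X = (X 0 * ev f fun j => X (j + 1))
      + ∑ i ∈ Finset.range n, (-1 : k) ^ (i + 1) • ev f (merge i X)
      + (-1 : k) ^ (n + 1) • (ev f X * X n) := by
  rw [hochschildDiff, ev_differential]
  rfl

/-- The outer entries absorb the two end terms of δ, so all terms become faces of one kind. -/
theorem ev_bar_hochschildDiff {n : ℕ} (f : HochschildCochain k A n) (X : ℕ → A) :
    ev (bar (hochschildDiff k A n f)) X =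
      ∑ l ∈ Finset.range (n + 2), (-1 : k) ^ l • ev (bar f) (merge l X) := by
  rw [Finset.sum_range_succ, Finset.sum_range_succ', ev_bar, ev_hochschildDiff]
  simp only [mul_add, add_mul, Finset.mul_sum, Finset.sum_mul, mul_smul_comm, smul_mul_assoc]
  have e1 : ev (bar f) (merge 0 X) = X 0 * (X 1 * ev f fun j => X (j + 1 + 1)) * X (n + 2) := by
    rw [ev_bar, ← mul_assoc (X 0)]
    rfl
  have e2 : ev (bar f) (merge (n + 1) X)
      = X 0 * ((ev f fun j => X (j + 1)) * X (n + 1)) * X (n + 2) := by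
    have : (ev f fun j => merge (n + 1) X (j + 1)) = ev f fun j => X (j + 1) :=
      ev_congr f fun j hj => by rw [merge_apply, if_pos (by omega)]
    rw [ev_bar, this, merge_apply, merge_apply, if_pos (by omega), if_neg (by omega), if_pos rfl]
    simp only [mul_assoc]
  have e3 : ∀ i < n, ev (bar f) (merge (i + 1) X)
      = X 0 * ev f (merge i fun j => X (j + 1)) * X (n + 2) := by
    intro i hi
    rw [ev_bar, merge_apply, if_pos (by omega), merge_apply, if_neg (by omega), if_neg (by omega)]
    congr 3
    funext j
    simp only [merge_apply, Nat.add_lt_add_iff_right, Nat.add_right_cancel_iff]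
  rw [e1, e2, pow_zero, one_smul, add_comm (∑ i ∈ _, _) (_ * _)]
  congr 2
  refine Finset.sum_congr rfl fun i hi => ?_
  rw [e3 i (Finset.mem_range.1 hi)]

/-- The usual argument for δδ = 0: the terms (l + 1, m) and (m, l), for m ≤ l, are equal and carry
opposite signs. -/
theorem sum_alternating_eq_zero {M : Type*} [AddCommGroup M] [Module k M] (N : ℕ)
    (a : ℕ → ℕ → M) (h : ∀ m l, m ≤ l → a (l + 1) m = a m l) :
    ∑ l ∈ Finset.range (N + 1), ∑ m ∈ Finset.range N, (-1 : k) ^ (l + m) • a l m = 0 := by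
  have e : ∀ l ∈ Finset.range (N + 1), ∑ m ∈ Finset.range N, (-1 : k) ^ (l + m) • a l m
      = ∑ m ∈ Finset.range l, (-1 : k) ^ (l + m) • a l m
        + ∑ m ∈ Finset.Ico l N, (-1 : k) ^ (l + m) • a l m := fun l hl =>
    (Finset.sum_range_add_sum_Ico _ (by simpa [Nat.lt_succ_iff] using hl)).symm
  have e' : ∑ l ∈ Finset.range (N + 1), ∑ m ∈ Finset.Ico l N, (-1 : k) ^ (l + m) • a l m
      = ∑ l ∈ Finset.range N, ∑ m ∈ Finset.range (l + 1), (-1 : k) ^ (m + l) • a m l := by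
    refine Finset.sum_comm' fun l m => ?_
    simp only [Finset.mem_range, Finset.mem_Ico]
    omega
  rw [Finset.sum_congr rfl e, Finset.sum_add_distrib, e', Finset.sum_range_succ',
    Finset.range_zero, Finset.sum_empty, add_zero, ← Finset.sum_add_distrib]
  refine Finset.sum_eq_zero fun l _ => ?_
  rw [← Finset.sum_add_distrib]
  refine Finset.sum_eq_zero fun m hm => ?_
  rw [h m l (by simpa [Nat.lt_succ_iff] using hm), ← add_smul]
  convert! zero_smul k _
  ring

theorem hochschildDiff_hochschildDiff {n : ℕ} (f : HochschildCochain k A n) :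
    hochschildDiff k A (n + 1) (hochschildDiff k A n f) = 0 := by
  refine bar_injective fun X => ?_
  rw [ev_bar_hochschildDiff]
  simp only [ev_bar_hochschildDiff, Finset.smul_sum, smul_smul, ← pow_add]
  rw [sum_alternating_eq_zero (n + 2) (fun l m => ev (bar f) (merge m (merge l X)))
    fun m l h => by rw [merge_merge h], ev_bar_zero]

end Bar

/-! ### The differential is a derivation of the Gerstenhaber bracket -/

section Derivation

variable {k A : Type*} [Field k] [Ring A] [Algebra k A]

/-- f ∘ μ consists of the inner terms of δf with opposite sign, and μ ∘ f of the two end terms. This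
makes the differential an inner operation of the bracket. -/
theorem gerstenhaberBracket_mul {p : ℕ} (f : HochschildCochain k A (p + 1)) :
    gerstenhaberBracket k A rfl f (bilinTwo (LinearMap.mul k A)) =
      -hochschildDiff k A (p + 1) f := by
  refine ev_ext fun X => ?_
  rw [gerstenhaberBracket_apply rfl (by omega), ← neg_one_smul k (hochschildDiff k A _ f),
    ev_smul, ev_hochschildDiff, ev_sub, ev_smul, ev_preLie, ev_preLie, Finset.sum_range_succ (n := 1),
    Finset.sum_range_one]
  have e1 : ev (bilinTwo (LinearMap.mul k A)) (replaceBlock 0 p (ev f fun l => X (0 + l)) X)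
      = ev f X * X (p + 1) := by
    simp [ev, bilinTwo, replaceBlock, add_comm 1 p]
  have e2 : ev (bilinTwo (LinearMap.mul k A)) (replaceBlock 1 p (ev f fun l => X (1 + l)) X)
      = X 0 * ev f fun l => X (l + 1) := by
    simp [ev, bilinTwo, replaceBlock, add_comm 1]
  have e3 : ∀ i, ev f (replaceBlock i 1 (ev (bilinTwo (LinearMap.mul k A)) fun l => X (i + l)) X)
      = ev f (merge i X) := fun i => rfl
  simp only [e1, e2, e3, pow_succ, pow_zero, zero_mul, one_mul, mul_one, smul_add, mul_neg,
    neg_smul, Finset.sum_neg_distrib, one_smul, smul_smul, neg_one_pow_mul_self, smul_neg,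
    neg_neg]
  simp only [add_comm _ 1, neg_smul, neg_mul, one_mul]
  abel

theorem hochschildDiff_gerstenhaberBracket {p q r : ℕ} (h : p + q = r)
    (h₁ : p + (q + 1) = r + 1) (h₂ : p + 1 + q = r + 1) (f : HochschildCochain k A (p + 1))
    (g : HochschildCochain k A (q + 1)) :
    hochschildDiff k A (r + 1) (gerstenhaberBracket k A h f g) =
      gerstenhaberBracket k A h₁ f (hochschildDiff k A (q + 1) g)
        + (-1 : k) ^ q • gerstenhaberBracket k A h₂ (hochschildDiff k A (p + 1) f) g := by
  obtain ⟨anti, jac⟩ := gerstenhaberBracket_isGradedLieBracket (k := k) (A := A)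
  -- Jacobi with the multiplication, of degree 1, as third entry; what remains is to turn each
  -- bracket with it into a differential and to compare signs.
  have J := jac (rfl : q + 1 = q + 1) (add_comm 1 p : 1 + p = p + 1) h h₁
    (by omega : q + (p + 1) = r + 1) (by omega : 1 + r = r + 1) f g (bilinTwo (LinearMap.mul k A))
  rw [anti (add_comm 1 p) rfl _ f, anti (by omega : 1 + r = r + 1) rfl, gerstenhaberBracket_mul,
    gerstenhaberBracket_mul, gerstenhaberBracket_mul,
    anti (by omega : q + (p + 1) = r + 1) h₂] at J
  simp only [map_neg, map_smul, LinearMap.smul_apply, smul_neg, neg_neg,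
    smul_smul, one_mul, mul_one, mul_add, mul_comm q p, pow_add] at J
  subst h
  simp only [pow_add] at J
  rcases neg_one_pow_eq_or k p with ha | ha <;>
  rcases neg_one_pow_eq_or k q with hb | hb <;>
  rcases neg_one_pow_eq_or k (p * q) with hc | hc <;>
  simp only [ha, hb, hc] at J ⊢
  all_goals first
    | linear_combination (norm := module) (1 : k) • J
    | linear_combination (norm := module) (-1 : k) • J

/-! ### Brackets with inner derivations. -/

/-- The sequence `(X₀, …, X_{i-1}, a, X_i, …)`. -/
def insertSeq (i : ℕ) (a : A) (X : ℕ → A) : ℕ → A := fun j =>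
  if j < i then X j else if j = i then a else X (j - 1)

theorem ev_curryMid {n : ℕ} (f : HochschildCochain k A (n + 1)) (i : Fin (n + 1)) (a : A)
    (X : ℕ → A) : ev (f.curryMid i a) X = ev f (insertSeq i a X) := by
  simp only [ev, MultilinearMap.curryMid_apply_apply]
  congr 1
  funext j
  rcases Fin.eq_self_or_eq_succAbove i j with rfl | ⟨t, rfl⟩
  · simp [insertSeq]
  · rw [Fin.insertNth_apply_succAbove]
    rcases lt_or_ge t.castSucc i with h | h
    · have h' : (t : ℕ) < i := h
      rw [Fin.succAbove_of_castSucc_lt _ _ h, insertSeq, Fin.val_castSucc, if_pos h']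
    · have h' : (i : ℕ) ≤ t := h
      rw [Fin.succAbove_of_le_castSucc _ _ h, insertSeq, Fin.val_succ, if_neg (by omega),
        if_neg (by omega), Nat.add_sub_cancel]

theorem ev_bar_curryMid {n : ℕ} (f : HochschildCochain k A (n + 1)) (i : Fin (n + 1)) (a : A)
    (X : ℕ → A) : ev (bar (f.curryMid i a)) X = ev (bar f) (insertSeq (i + 1) a X) := by
  have hi := i.2
  rw [ev_bar, ev_bar, ev_curryMid]
  congr 1
  · congr 2
    funext j
    simp only [insertSeq]
    split_ifs <;> first | omega | rfl | (congr 1; omega)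
  · simp only [insertSeq]
    split_ifs <;> first | omega | rfl

theorem insertSeq_merge_of_lt {l i : ℕ} (h : l < i) (a : A) (X : ℕ → A) :
    insertSeq i a (merge l X) = merge l (insertSeq (i + 1) a X) := by
  funext j
  simp only [insertSeq, merge_apply]
  split_ifs <;> first | omega | rfl | (congr 1; omega)

theorem insertSeq_merge_of_ge {l i : ℕ} (h : i ≤ l) (a : A) (X : ℕ → A) :
    insertSeq i a (merge l X) = merge (l + 1) (insertSeq i a X) := by
  funext j
  simp only [insertSeq, merge_apply]
  split_ifs <;> first | omega | rfl | (congr 1; omega)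

theorem merge_insertSeq_left (i : ℕ) (a : A) (X : ℕ → A) :
    merge i (insertSeq (i + 1) a X) = Function.update X i (X i * a) := by
  funext j
  simp only [insertSeq, merge_apply, Function.update_apply]
  split_ifs <;> first | omega | rfl

theorem merge_insertSeq_right (i : ℕ) (a : A) (X : ℕ → A) :
    merge (i + 1) (insertSeq (i + 1) a X) = Function.update X (i + 1) (a * X (i + 1)) := by
  funext j
  simp only [insertSeq, merge_apply, Function.update_apply]
  split_ifs <;> first | omega | rfl

/-- Bracketing a cocycle with an inner derivation gives a coboundary. -/
theorem gerstenhaberBracket_hochschildDiff_zero {p : ℕ} (f : HochschildCochain k A (p + 1))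
    (hf : hochschildDiff k A (p + 1) f = 0) (c : HochschildCochain k A 0) :
    gerstenhaberBracket k A (rfl : p + 0 = p) f (hochschildDiff k A 0 c) =
      hochschildDiff k A p (∑ i : Fin (p + 1), (-1 : k) ^ (i : ℕ) • f.curryMid i (c ![])) := by
  set a := c ![] with ha
  refine bar_injective fun X => ?_
  set F := bar f with hF
  -- In bar form, P i and Q i multiply X_i by a on the right and on the left, while c' i l
  -- multiplies the neighbours at l and then inserts a at slot i.
  obtain ⟨P, hP⟩ : ∃ P : ℕ → A, ∀ i, P i = ev F (Function.update X i (X i * a)) :=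
    ⟨_, fun _ => rfl⟩
  obtain ⟨Q, hQ⟩ : ∃ Q : ℕ → A, ∀ i, Q i = ev F (Function.update X i (a * X i)) :=
    ⟨_, fun _ => rfl⟩
  obtain ⟨c', hc'⟩ : ∃ c' : ℕ → ℕ → A, ∀ i l, c' i l = ev F (insertSeq i a (merge l X)) :=
    ⟨_, fun _ _ => rfl⟩
  -- The cocycle condition, evaluated with a inserted between X_i and X_{i+1}: the two faces
  -- involving a are P i and Q (i + 1), and the other faces are values of c'.
  have expand : ∀ i < p + 2, ∑ l ∈ Finset.range i, (-1 : k) ^ l • c' i l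
      + (-1 : k) ^ i • P i + (-1 : k) ^ (i + 1) • Q (i + 1)
        + ∑ l ∈ Finset.Ico (i + 1) (p + 2), (-1 : k) ^ (l + 1) • c' (i + 1) l = 0 := by
    intro i hi
    have h := ev_bar_hochschildDiff f (insertSeq (i + 1) a X)
    rw [hf, ev_bar_zero, ← Finset.sum_range_add_sum_Ico (M := A) _
      (by omega : i + 1 + 1 ≤ p + 1 + 2), Finset.sum_range_succ, Finset.sum_range_succ,
      ← Finset.sum_Ico_add' _ (i + 1) (p + 2) 1] at h
    refine Eq.trans ?_ h.symm
    congr 1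
    · congr 1
      · congr 1
        · refine Finset.sum_congr rfl fun l hl => ?_
          rw [hc', insertSeq_merge_of_lt (Finset.mem_range.1 hl)]
        · rw [hP, merge_insertSeq_left]
      · rw [hQ, merge_insertSeq_right]
    · refine Finset.sum_congr rfl fun l hl => ?_
      rw [hc', insertSeq_merge_of_ge (Finset.mem_Ico.1 hl).1]
  -- The relations are summed with signs (-1)^i. The faces left of a in relation i + 1 and right of
  -- a in relation i together run through c' (i + 1) l for all l.
  have total : ∑ i ∈ Finset.range (p + 1), ∑ l ∈ Finset.range (p + 2), (-1 : k) ^ (i + l) •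
      c' (i + 1) l = ∑ i ∈ Finset.range (p + 2), (P i - Q (i + 1)) := by
    have h : ∀ i ∈ Finset.range (p + 2), P i - Q (i + 1) =
        -(∑ l ∈ Finset.range i, (-1 : k) ^ (i + l) • c' i l
        + ∑ l ∈ Finset.Ico (i + 1) (p + 2), (-1 : k) ^ (i + l + 1) • c' (i + 1) l) := by
      intro i hi
      have h := congrArg (fun z => (-1 : k) ^ i • z) (expand i (Finset.mem_range.1 hi))
      simp only [smul_add, smul_smul, ← pow_add, Finset.smul_sum, smul_zero, ← add_assoc] at h
      rw [pow_add _ i i, pow_succ _ (i + i), pow_add, neg_one_pow_mul_self] at h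
      linear_combination (norm := module) (1 : k) • h
    rw [Finset.sum_congr rfl h, Finset.sum_neg_distrib, Finset.sum_add_distrib,
      Finset.sum_range_succ' _ (p + 1), Finset.sum_range_succ _ (p + 1), Finset.Ico_self,
      Finset.sum_empty, Finset.range_zero, Finset.sum_empty, add_zero, add_zero,
      ← Finset.sum_add_distrib, ← Finset.sum_neg_distrib]
    refine Finset.sum_congr rfl fun i hi => ?_
    rw [Finset.mem_range] at hi
    rw [← Finset.sum_range_add_sum_Ico _ (by omega : i + 1 ≤ p + 2), neg_add,
      ← Finset.sum_neg_distrib, ← Finset.sum_neg_distrib]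
    congr 1 <;> refine Finset.sum_congr rfl fun l _ => ?_ <;> rw [← neg_smul] <;> congr 1 <;> ring
  have e1 : ev (bar (preLie LinearMap.id (rfl : p + 0 = p) f (hochschildDiff k A 0 c))) X
      = ∑ i ∈ Finset.range (p + 1), (P (i + 1) - Q (i + 1)) := by
    rw [ev_bar, ev_preLie, Finset.mul_sum, Finset.sum_mul]
    refine Finset.sum_congr rfl fun i hi => ?_
    rw [Finset.mem_range] at hi
    rw [mul_zero, pow_zero, one_smul]
    have e : (ev (hochschildDiff k A 0 c) fun l => X (i + l + 1))
        = X (i + 1) * a - a * X (i + 1) := by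
      rw [ev_hochschildDiff, sub_eq_add_neg]
      simp [ev, ha, Subsingleton.elim (fun i : Fin 0 => _) ![]]
    rw [hP, hQ, ev_update F X (by omega : i + 1 < p + 1 + 1 + 1), ev_update F X (by omega), ← map_sub,
      ← ev_update, ← e, ev_bar, Function.update_of_ne (by omega), Function.update_of_ne (by omega)]
    congr 3
    funext j
    simp only [replaceBlock, Function.update_apply]
    split_ifs <;> first | omega | rfl
  have e2 : ev (bar (preLie LinearMap.id (by omega : 0 + p = p) (hochschildDiff k A 0 c) f)) X
      = Q (p + 2) - P 0 := by
    have hQ' : Q (p + 2) = X 0 * (ev f fun j => X (j + 1)) * (a * X (p + 2)) := by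
      rw [hQ, ev_bar, Function.update_of_ne (by omega), Function.update_self]
      congr 2
      exact ev_congr f fun j hj => by rw [Function.update_of_ne (by omega)]
    have hP' : P 0 = X 0 * a * (ev f fun j => X (j + 1)) * X (p + 2) := by
      rw [hP, ev_bar, Function.update_self, Function.update_of_ne (by omega)]
      congr 2
    rw [ev_bar, ev_preLie, Finset.sum_range_one, zero_mul, pow_zero, one_smul,
      ev_hochschildDiff, hQ', hP']
    simp [ev, ha, Subsingleton.elim (fun i : Fin 0 => _) ![], replaceBlock]
    noncomm_ring
  rw [gerstenhaberBracket_apply rfl (by omega), bar_sub, bar_smul, ev_sub, ev_smul, e1, e2,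
    mul_zero, pow_zero, one_smul, ev_bar_hochschildDiff]
  simp only [ev_bar_sum, bar_smul, ev_smul, ev_bar_curryMid, ← hF, ← hc', Finset.smul_sum, smul_smul]
  rw [Finset.sum_comm]
  have e3 := total
  rw [Finset.sum_range] at e3
  simp only [pow_add, mul_comm ((-1 : k) ^ (_ : Fin _).val)] at e3 ⊢
  -- The sum of P i - Q (i + 1) over i ≤ p + 1 regroups into the sum of P (i + 1) - Q (i + 1) over i
  -- ≤ p, which is f ∘ δc, plus P 0 - Q (p + 2), which is -(δc) ∘ f.
  rw [e3, Finset.sum_sub_distrib, Finset.sum_sub_distrib, Finset.sum_range_succ' P,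
    Finset.sum_range_succ _ (p + 1)]
  abel

end Derivation

end ReducedBracket

end

noncomputable section

namespace ReducedBracket

/-! ### Normalized cochains -/

section Normalized

variable {k A : Type*} [Field k] [Ring A] [Algebra k A]

/-- A cochain vanishes if one of its first `m` arguments lies in the subalgebra `E`. -/
def VanishesUpTo (E : Subalgebra k A) (m : ℕ) {n : ℕ} (f : HochschildCochain k A n) : Prop :=
  ∀ (X : ℕ → A) (j : ℕ), j < m → X j ∈ E → ev f X = 0

/-- A cochain vanishes if one of its arguments lies in the subalgebra `E`. -/
abbrev IsNormalized (E : Subalgebra k A) {n : ℕ} (f : HochschildCochain k A n) : Prop :=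
  VanishesUpTo E n f

/-- A cochain, in its bar form, is a map on the tensor power over the subalgebra `E`. -/
def IsBalanced (E : Subalgebra k A) {n : ℕ} (f : HochschildCochain k A n) : Prop :=
  ∀ j ≤ n, ∀ e ∈ E, ∀ X : ℕ → A, ev (bar f) (Function.update X j (X j * e)) =
    ev (bar f) (Function.update X (j + 1) (e * X (j + 1)))

variable {E : Subalgebra k A}

theorem VanishesUpTo.ev_bar_eq_zero {m n : ℕ} {f : HochschildCochain k A n}
    (h : VanishesUpTo E m f) (X : ℕ → A) (j : ℕ) (hj : 0 < j) (hjm : j ≤ m) (hX : X j ∈ E) :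
    ev (bar f) X = 0 := by
  obtain ⟨j, rfl⟩ := Nat.exists_eq_succ_of_ne_zero hj.ne'
  rw [ev_bar, h (fun t => X (t + 1)) j hjm hX, mul_zero, zero_mul]

theorem vanishesUpTo_of_ev_bar {m n : ℕ} (hmn : m ≤ n) {f : HochschildCochain k A n}
    (h : ∀ (X : ℕ → A) (j : ℕ), j < m → X (j + 1) ∈ E → ev (bar f) X = 0) :
    VanishesUpTo E m f := by
  intro X j hj hX
  rw [← ev_bar_padOne]
  refine h _ j hj ?_
  rw [padOne, if_neg (by omega), if_neg (by omega)]
  exact hX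

/-- A face not involving the entry in E keeps it as an argument of f and vanishes. Only the products
with its two neighbours survive. -/
theorem IsNormalized.ev_bar_hochschildDiff {n : ℕ} {f : HochschildCochain k A n}
    (hf : IsNormalized E f) (X : ℕ → A) {j : ℕ} (hj : j ≤ n) (hX : X (j + 1) ∈ E) :
    ev (bar (hochschildDiff k A n f)) X =
      (-1 : k) ^ j • (ev (bar f) (merge j X) - ev (bar f) (merge (j + 1) X)) := by
  rw [ReducedBracket.ev_bar_hochschildDiff, Finset.sum_eq_add j (j + 1) (by omega)]
  · rw [pow_succ]
    module
  · intro l hl hlj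
    rw [Finset.mem_range] at hl
    rcases lt_or_ge l j with h | h
    · rw [hf.ev_bar_eq_zero _ j (by omega) hj, smul_zero]
      rw [merge_apply, if_neg (by omega), if_neg (by omega)]
      exact hX
    · rw [hf.ev_bar_eq_zero _ (j + 1) (by omega) (by omega), smul_zero]
      rw [merge_apply, if_pos (by omega)]
      exact hX
  · intro h
    exact absurd (Finset.mem_range.2 (by omega)) h
  · intro h
    exact absurd (Finset.mem_range.2 (by omega)) h

/-- With e inserted between X_j and X_{j+1}, δf vanishes, and its two surviving faces are the two
sides of the balancing relation. -/
theorem IsNormalized.isBalanced {n : ℕ} {f : HochschildCochain k A n} (hf : IsNormalized E f)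
    (hd : IsNormalized E (hochschildDiff k A n f)) : IsBalanced E f := by
  intro j hj e he X
  have hX : insertSeq (j + 1) e X (j + 1) ∈ E := by simpa [insertSeq] using he
  have h := hf.ev_bar_hochschildDiff _ hj hX
  rw [hd.ev_bar_eq_zero _ (j + 1) (by omega) (by omega) hX, merge_insertSeq_left,
    merge_insertSeq_right] at h
  rcases smul_eq_zero.1 h.symm with h | h
  · exact absurd h (pow_ne_zero _ (by simp))
  · exact sub_eq_zero.1 h

/-- The converse: for balanced f the two surviving faces cancel. -/
theorem IsNormalized.hochschildDiff {n : ℕ} {f : HochschildCochain k A n} (hf : IsNormalized E f)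
    (hb : IsBalanced E f) : IsNormalized E (hochschildDiff k A n f) := by
  refine vanishesUpTo_of_ev_bar le_rfl fun X j hj hX => ?_
  rw [hf.ev_bar_hochschildDiff X (Nat.lt_succ_iff.1 hj) hX]
  -- Y is X with its entry j + 1, the one in E, deleted.
  obtain ⟨Y, hY⟩ : ∃ Y, X = insertSeq (j + 1) (X (j + 1)) Y := by
    refine ⟨fun t => if t < j + 1 then X t else X (t + 1), ?_⟩
    funext t
    simp only [insertSeq]
    split_ifs <;> first | omega | rfl | (congr 1; omega) | (subst_vars; rfl)
  generalize X (j + 1) = e at hX hY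
  rw [hY, merge_insertSeq_left, merge_insertSeq_right, hb j (Nat.lt_succ_iff.1 hj) e hX, sub_self,
    smul_zero]

/-! ### Balancedness read off outside the bar form. -/

theorem update_padOne {n j : ℕ} (hj : j < n) (X : ℕ → A) (v : A) :
    Function.update (padOne n X) (j + 1) v = padOne n (Function.update X j v) := by
  funext t
  simp only [padOne, Function.update_apply]
  split_ifs <;> first | omega | rfl

theorem padOne_succ {n j : ℕ} (hj : j < n) (X : ℕ → A) : padOne n X (j + 1) = X j := by
  rw [padOne, if_neg (by omega), if_neg (by omega), Nat.add_sub_cancel]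

theorem ev_padOne_shift {n : ℕ} (f : HochschildCochain k A n) (X : ℕ → A) :
    (ev f fun j => padOne n X (j + 1)) = ev f X :=
  ev_congr f fun _ hj => padOne_succ hj X

theorem ev_bar_update_zero {n : ℕ} (f : HochschildCochain k A n) (X : ℕ → A) (e : A) :
    ev (bar f) (Function.update (padOne n X) 0 e) = e * ev f X := by
  rw [ev_bar, Function.update_self, Function.update_of_ne (by omega), ← ev_padOne_shift f X]
  simp [padOne]

theorem ev_bar_update_last {n : ℕ} (f : HochschildCochain k A n) (X : ℕ → A) (e : A) :
    ev (bar f) (Function.update (padOne n X) (n + 1) e) = ev f X * e := by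
  have h : (ev f fun j => Function.update (padOne n X) (n + 1) e (j + 1)) = ev f X := by
    rw [← ev_padOne_shift f X]
    exact ev_congr f fun j hj => Function.update_of_ne (by omega) _ _
  rw [ev_bar, Function.update_self, Function.update_of_ne (by omega), h]
  simp [padOne]

theorem IsBalanced.mul_comm {f : HochschildCochain k A 0} (hf : IsBalanced E f) {e : A}
    (he : e ∈ E) (X : ℕ → A) : e * ev f X = ev f X * e := by
  have h := hf 0 le_rfl e he (padOne 0 X)
  rw [ev_bar_update_zero, ev_bar_update_last] at h
  simpa [padOne] using h

theorem IsBalanced.ev_update_mul_left {n : ℕ} {f : HochschildCochain k A n} (hf : IsBalanced E f)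
    (hn : 0 < n) {e : A} (he : e ∈ E) (X : ℕ → A) :
    ev f (Function.update X 0 (e * X 0)) = e * ev f X := by
  have h := hf 0 (by omega) e he (padOne n X)
  rw [ev_bar_update_zero, update_padOne hn, padOne_succ hn, ev_bar_padOne] at h
  simpa [padOne] using h.symm

theorem IsBalanced.ev_update_mul_right {n : ℕ} {f : HochschildCochain k A n}
    (hf : IsBalanced E f) (hn : 0 < n) {e : A} (he : e ∈ E) (X : ℕ → A) :
    ev f (Function.update X (n - 1) (X (n - 1) * e)) = ev f X * e := by
  obtain ⟨n, rfl⟩ := Nat.exists_eq_succ_of_ne_zero hn.ne'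
  have h := hf (n + 1) le_rfl e he (padOne (n + 1) X)
  rw [ev_bar_update_last, update_padOne (Nat.lt_succ_self n), padOne_succ (Nat.lt_succ_self n),
    ev_bar_padOne] at h
  simpa [padOne] using h

theorem IsBalanced.ev_update_mul_mid {n : ℕ} {f : HochschildCochain k A n} (hf : IsBalanced E f)
    {i : ℕ} (hi : i + 1 < n) {e : A} (he : e ∈ E) (X : ℕ → A) :
    ev f (Function.update X i (X i * e)) = ev f (Function.update X (i + 1) (e * X (i + 1))) := by
  have h := hf (i + 1) (by omega) e he (padOne n X)
  rwa [update_padOne (by omega), update_padOne hi, padOne_succ (by omega), padOne_succ hi,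
    ev_bar_padOne, ev_bar_padOne] at h

theorem ev_update_smul_self {n : ℕ} (f : HochschildCochain k A n) (X : ℕ → A) {j : ℕ} (hj : j < n)
    (c : k) : ev f (Function.update X j (c • X j)) = c • ev f X := by
  rw [ev_update f X hj, map_smul, ← ev_update, Function.update_eq_self]

/-! ### The splitting homotopy and successive normalization. -/

/-- Entry 0 is the outer left factor, so there e moves onto the value of f; for i > 0 it is absorbed
by precomposing an argument. -/
theorem exists_bar_eq_update_mul {n : ℕ} (f : HochschildCochain k A n) {i : ℕ} (hi : i ≤ n)
    (e : A) : ∃ g : HochschildCochain k A n, ∀ X : ℕ → A,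
      ev (bar g) X = ev (bar f) (Function.update X i (X i * e)) := by
  rcases Nat.eq_zero_or_pos i with rfl | hi0
  · refine ⟨(LinearMap.mulLeft k e).compMultilinearMap f, fun X => ?_⟩
    rw [ev_bar, ev_bar, Function.update_self, Function.update_of_ne (by omega), mul_assoc (X 0) e]
    rfl
  · refine ⟨f.compLinearMap fun j => if j + 1 = i then LinearMap.mulRight k e else LinearMap.id,
      fun X => ?_⟩
    rw [ev_bar, ev_bar, Function.update_of_ne (by omega), Function.update_of_ne (by omega)]
    congr 2
    simp only [ev, MultilinearMap.compLinearMap_apply]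
    congr 1
    funext j
    simp only [Function.update_apply]
    split_ifs with h
    · simp [h]
    · rfl

/-- The sequence `(X₀, …, X_i e, e, X_{i+1}, …)`. -/
def splitSeq (i : ℕ) (e : A) (X : ℕ → A) : ℕ → A := fun j =>
  if j < i then X j else if j = i then X i * e else if j = i + 1 then e else X (j - 1)

theorem exists_bar_eq_splitSeq {n : ℕ} (f : HochschildCochain k A (n + 1)) {i : ℕ} (hi : i ≤ n)
    (e : A) : ∃ g : HochschildCochain k A n, ∀ X : ℕ → A,
      ev (bar g) X = ev (bar f) (splitSeq i e X) := by
  obtain ⟨g, hg⟩ := exists_bar_eq_update_mul (f.curryMid ⟨i, by omega⟩ e) hi e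
  refine ⟨g, fun X => ?_⟩
  rw [hg, ev_bar_curryMid]
  congr 1
  funext j
  simp only [insertSeq, splitSeq, Function.update_apply]
  split_ifs <;> first | omega | rfl

/-- The boundary case l = i belongs here: X_i X_{i+1} e is the product of X_i with the already split
entry X_{i+1} e. -/
theorem splitSeq_merge_of_le {l i : ℕ} (h : l ≤ i) (e : A) (X : ℕ → A) :
    splitSeq i e (merge l X) = merge l (splitSeq (i + 1) e X) := by
  funext j
  simp only [splitSeq, merge_apply]
  split_ifs <;> first | omega | rfl | (congr 1; omega) | (subst_vars; simp [mul_assoc])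

theorem splitSeq_merge_of_gt {l i : ℕ} (h : i < l) (e : A) (X : ℕ → A) :
    splitSeq i e (merge l X) = merge (l + 1) (splitSeq i e X) := by
  funext j
  simp only [splitSeq, merge_apply]
  split_ifs <;> first | omega | rfl | (congr 1; omega)

theorem merge_splitSeq_self {i : ℕ} {e : A} (he : e * e = e) (X : ℕ → A) :
    merge i (splitSeq i e X) = Function.update X i (X i * e) := by
  funext j
  simp only [splitSeq, merge_apply, Function.update_apply]
  split_ifs <;> first | omega | rfl | (simp [mul_assoc, he])

variable {ι : Type*} [Fintype ι] {e : ι → A}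

/-- The cochain g is, up to sign, the sum over a of f on the sequence with X_i split into X_i e_a,
e_a. Normalization of δf at the entry e_a relates δg to f: the face X_i e_a e_a = X_i e_a restores f
after summation over a, and the right-hand side collects the faces left unmatched. -/
theorem exists_homotopy (heE : ∀ a, e a ∈ E) (he : ∀ a, e a * e a = e a) (hsum : ∑ a, e a = 1)
    {n i : ℕ} (hi : i ≤ n) {f : HochschildCochain k A (n + 1)} (hf : VanishesUpTo E i f)
    (hd : IsNormalized E (hochschildDiff k A (n + 1) f)) :
    ∃ g : HochschildCochain k A n, ∀ X, ev (bar (f - hochschildDiff k A n g)) X =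
      ∑ a, (ev (bar f) (merge (i + 1) (splitSeq i (e a) X)) - (-1 : k) ^ i •
        ∑ l ∈ Finset.range (i + 1), (-1 : k) ^ l •
          ev (bar f) (merge l (splitSeq (i + 1) (e a) X))) := by
  choose g hg using fun a => exists_bar_eq_splitSeq f hi (e a)
  refine ⟨(-1 : k) ^ i • ∑ a, g a, fun X => ?_⟩
  have key : ∀ a, (-1 : k) ^ i • ∑ l ∈ Finset.range (n + 2), (-1 : k) ^ l •
      ev (bar (g a)) (merge l X) = ev (bar f) (Function.update X i (X i * e a))
      - (ev (bar f) (merge (i + 1) (splitSeq i (e a) X)) - (-1 : k) ^ i •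
        ∑ l ∈ Finset.range (i + 1), (-1 : k) ^ l •
          ev (bar f) (merge l (splitSeq (i + 1) (e a) X))) := by
    intro a
    -- Slot i + 1 of the split sequence is e_a, so this expansion equals zero. Its faces l < i also
    -- vanish, since they move e_a to slot i, where f already vanishes on E.
    have h := ev_bar_hochschildDiff f (splitSeq i (e a) X)
    rw [hd.ev_bar_eq_zero _ (i + 1) (by omega) (by omega) (by simpa [splitSeq] using heE a),
      ← Finset.sum_range_add_sum_Ico (M := A) _ (by omega : i + 1 + 1 ≤ n + 1 + 2),
      Finset.sum_range_succ, Finset.sum_range_succ, Finset.sum_eq_zero,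
      ← Finset.sum_Ico_add' _ (i + 1) (n + 2) 1, merge_splitSeq_self (he a)] at h
    · rw [← Finset.sum_range_add_sum_Ico (M := A) _ (by omega : i + 1 ≤ n + 2)]
      have h1 : ∑ l ∈ Finset.range (i + 1), (-1 : k) ^ l • ev (bar (g a)) (merge l X)
          = ∑ l ∈ Finset.range (i + 1), (-1 : k) ^ l •
            ev (bar f) (merge l (splitSeq (i + 1) (e a) X)) :=
        Finset.sum_congr rfl fun l hl => by
          rw [hg, splitSeq_merge_of_le (Nat.lt_succ_iff.1 (Finset.mem_range.1 hl))]
      have h2 : ∑ l ∈ Finset.Ico (i + 1) (n + 2), (-1 : k) ^ l • ev (bar (g a)) (merge l X)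
          = - ∑ l ∈ Finset.Ico (i + 1) (n + 2), (-1 : k) ^ (l + 1) •
            ev (bar f) (merge (l + 1) (splitSeq i (e a) X)) := by
        rw [← Finset.sum_neg_distrib]
        refine Finset.sum_congr rfl fun l hl => ?_
        rw [hg, splitSeq_merge_of_gt (Finset.mem_Ico.1 hl).1, pow_succ]
        module
      rw [h1, h2]
      rcases neg_one_pow_eq_or k i with hs | hs <;> simp only [hs, pow_succ] at h ⊢
      · linear_combination (norm := module) (1 : k) • h
      · linear_combination (norm := module) (-1 : k) • h
    · intro l hl
      rw [Finset.mem_range] at hl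
      rw [hf.ev_bar_eq_zero _ i (by omega) le_rfl, smul_zero]
      simpa [merge_apply, splitSeq, hl.not_gt, hl.ne'] using heE a
  -- Here ∑ e_a = 1 enters.
  have total : ∑ a, ev (bar f) (Function.update X i (X i * e a)) = ev (bar f) X := by
    have hi' : i < n + 1 + 1 + 1 := by omega
    simp only [ev_update (bar f) X hi']
    rw [← map_sum, ← ev_update, ← Finset.mul_sum, hsum, mul_one, Function.update_eq_self]
  rw [bar_sub, ev_sub, map_smul, bar_smul, ev_smul, map_sum, ev_bar_sum, Finset.smul_sum]
  simp only [ev_bar_hochschildDiff]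
  rw [Finset.sum_congr rfl fun a _ => key a, Finset.sum_sub_distrib, total, sub_sub_cancel]

/-- The remainder in `exists_homotopy` vanishes for an E-entry among the first i + 1 arguments.
Earlier arguments are handled by the vanishing of f and δf; in the new argument, an element of E
acts on e_a by the same scalar from both sides, and the two remaining terms cancel. -/
theorem exists_vanishesUpTo_succ (heE : ∀ a, e a ∈ E) (he : ∀ a, e a * e a = e a)
    (hsum : ∑ a, e a = 1)
    (hsc : ∀ x ∈ E, ∀ a, ∃ c : k, x * e a = c • e a ∧ e a * x = c • e a)
    {n i : ℕ} (hi : i ≤ n) {f : HochschildCochain k A (n + 1)} (hf : VanishesUpTo E i f)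
    (hd : IsNormalized E (hochschildDiff k A (n + 1) f)) :
    ∃ g : HochschildCochain k A n, VanishesUpTo E (i + 1) (f - hochschildDiff k A n g) := by
  obtain ⟨g, hg⟩ := exists_homotopy heE he hsum hi hf hd
  refine ⟨g, vanishesUpTo_of_ev_bar (by omega) fun X j hj hX => ?_⟩
  rw [hg]
  refine Finset.sum_eq_zero fun a _ => ?_
  rcases (Nat.lt_succ_iff.1 hj).lt_or_eq with hji | rfl
  -- Again e_a makes δf vanish, now at slot i + 2. The faces l > i leave X_{j+1} in place and
  -- vanish, so the partial sum over l ≤ i is zero by itself.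
  · have h := ev_bar_hochschildDiff f (splitSeq (i + 1) (e a) X)
    rw [hd.ev_bar_eq_zero _ (i + 1 + 1) (by omega) (by omega) (by simpa [splitSeq] using heE a),
      ← Finset.sum_range_add_sum_Ico (M := A) _ (by omega : i + 1 ≤ n + 1 + 2),
      Finset.sum_eq_zero (s := Finset.Ico _ _), add_zero] at h
    · rw [← h, smul_zero, sub_zero]
      refine hf.ev_bar_eq_zero _ (j + 1) (by omega) (by omega) ?_
      simp only [merge_apply, splitSeq]
      split_ifs <;> first | omega | exact hX | skip
      have : j + 1 = i := by omega
      exact E.mul_mem (this ▸ hX) (heE a)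
    · intro l hl
      rw [Finset.mem_Ico] at hl
      rw [hf.ev_bar_eq_zero _ (j + 1) (by omega) (by omega), smul_zero]
      simp only [merge_apply, splitSeq]
      split_ifs <;> first | exact hX | omega
  · obtain ⟨c, hc1, hc2⟩ := hsc _ hX a
    rw [Finset.sum_range_succ, Finset.sum_eq_zero, zero_add, smul_smul, neg_one_pow_mul_self,
      one_smul, sub_eq_zero]
    -- Both terms are c times the value at Z, which carries X_j e_a, e_a in slots j, j + 1: in one,
    -- X_{j+1} is absorbed by the second e_a from the right, in the other by the first from the
    -- left.
    · set Z := Function.update (merge (j + 1) (splitSeq j (e a) X)) (j + 1) (e a) with hZ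
      have e1 : merge (j + 1) (splitSeq j (e a) X)
          = Function.update Z (j + 1) (c • Z (j + 1)) := by
        funext t
        simp only [hZ, Function.update_apply, merge_apply, splitSeq]
        split_ifs <;> first | omega | rfl | simpa using hc2
      have e2 : merge j (splitSeq (j + 1) (e a) X) = Function.update Z j (c • Z j) := by
        funext t
        simp only [hZ, Function.update_apply, merge_apply, splitSeq]
        split_ifs <;> first | omega | rfl | (subst_vars; rw [hc1, mul_smul_comm])
      rw [e1, e2, ev_update_smul_self _ _ (by omega), ev_update_smul_self _ _ (by omega)]
    · intro l hl
      rw [Finset.mem_range] at hl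
      rw [hf.ev_bar_eq_zero _ j (by omega) le_rfl, smul_zero]
      simp only [merge_apply, splitSeq]
      split_ifs <;> first | omega | exact E.mul_mem hX (heE a)

theorem exists_sub_isNormalized (heE : ∀ a, e a ∈ E) (he : ∀ a, e a * e a = e a)
    (hsum : ∑ a, e a = 1)
    (hsc : ∀ x ∈ E, ∀ a, ∃ c : k, x * e a = c • e a ∧ e a * x = c • e a)
    {n : ℕ} (f : HochschildCochain k A (n + 1))
    (hd : IsNormalized E (hochschildDiff k A (n + 1) f)) :
    ∃ g : HochschildCochain k A n, IsNormalized E (f - hochschildDiff k A n g) := by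
  suffices h : ∀ m ≤ n + 1, ∃ g : HochschildCochain k A n,
      VanishesUpTo E m (f - hochschildDiff k A n g) from h (n + 1) le_rfl
  intro m
  induction m with
  | zero => exact fun _ => ⟨0, fun X j hj => absurd hj (by omega)⟩
  | succ m ih =>
    intro hm
    obtain ⟨g, hg⟩ := ih (by omega)
    -- Subtracting a coboundary leaves the differential of f unchanged, so the hypothesis on it
    -- persists through the induction.
    obtain ⟨g', hg'⟩ := exists_vanishesUpTo_succ heE he hsum hsc (by omega : m ≤ n) hg
      (by rw [map_sub, hochschildDiff_hochschildDiff, sub_zero]; exact hd)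
    exact ⟨g + g', by rwa [map_add, ← sub_sub]⟩

end Normalized

end ReducedBracket

end

noncomputable section

namespace ReducedBracket

section Comparison

variable {k A : Type*} [Field k] [Ring A] [Algebra k A] {N : ℕ}

namespace RadicalSplitting

variable (D : RadicalSplitting k A N)

/-! ### The idempotents -/

theorem idem_mem (a : Fin N) : D.idem a ∈ D.E := (D.equiv.symm (Pi.single a 1)).2

theorem idem_mul_self (a : Fin N) : D.idem a * D.idem a = D.idem a := by
  have h : D.equiv.symm (Pi.single a 1) * D.equiv.symm (Pi.single a 1)
      = D.equiv.symm (Pi.single a 1) := by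
    rw [← map_mul, ← Pi.single_mul, one_mul]
  exact congrArg Subtype.val h

theorem sum_idem : ∑ a, D.idem a = 1 := by
  have h : ∑ a, D.equiv.symm (Pi.single a 1) = 1 := by
    rw [← map_sum, Finset.univ_sum_single (fun _ : Fin N => (1 : k))]
    exact map_one D.equiv.symm
  have h' := congrArg Subtype.val h
  simpa [idem] using h'

/-! ### The map `p` -/

theorem pMap_apply {n : ℕ} (f : D.reducedCochain n) (x : Fin n → A) :
    D.pMap n f x = f.1 fun i => D.proj (x i) := rfl

theorem ev_pMap {n : ℕ} (f : D.reducedCochain n) (X : ℕ → A) :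
    ev (D.pMap n f) X = ev f.1 fun i => D.proj (X i) := rfl

theorem proj_coe (x : rad k A) : D.proj x = x :=
  Subtype.ext (proj_of_mem_rad x.2)

theorem pMap_apply_coe {n : ℕ} (f : D.reducedCochain n) (x : Fin n → rad k A) :
    D.pMap n f (fun i => x i) = f.1 x := by
  rw [pMap_apply]
  simp only [proj_coe]

theorem pMap_injective (n : ℕ) : Function.Injective (D.pMap n) := by
  intro f g h
  refine Subtype.ext (MultilinearMap.ext fun x => ?_)
  rw [← pMap_apply_coe, ← pMap_apply_coe, h]

theorem isNormalized_pMap {n : ℕ} (f : D.reducedCochain n) : IsNormalized D.E (D.pMap n f) := by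
  intro X j hj hX
  exact f.1.map_coord_zero ⟨j, hj⟩ (proj_of_mem hX)

/-- The cases n = 0, j = 0, 0 < j < n and j = n > 0 are the four clauses of a bimodule map; π passes
elements of E through on either side. -/
theorem isBalanced_pMap {n : ℕ} (f : D.reducedCochain n) : IsBalanced D.E (D.pMap n f) := by
  intro j hj e he X
  rw [ev_bar, ev_bar, ev_pMap, ev_pMap]
  rcases Nat.eq_zero_or_pos j with rfl | hj0
  · rw [Function.update_self, Function.update_of_ne (by omega),
      Function.update_of_ne (a := 0) (by omega)]
    rcases Nat.eq_zero_or_pos n with rfl | hn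
    · obtain ⟨v, hv⟩ : ∃ v, ∀ Y, ev f.1 Y = v := ⟨ev f.1 0, fun Y => ev_congr _ (by omega)⟩
      have h : e * v = v * e := by
        rw [← hv 0]
        exact f.2.zero rfl e he _
      rw [Function.update_self, hv, hv, mul_assoc (X 0), h, ← mul_assoc, mul_assoc _ e]
    · rw [Function.update_of_ne (by omega)]
      congr 1
      rw [mul_assoc (X 0)]
      congr 1
      refine (f.2.left hn e he _ _ ?_ ?_).symm
      · simp [proj_mul_left he]
      · intro t ht
        simp only [Function.update_apply]
        rw [if_neg (by omega), if_neg (by omega)]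
  · rw [Function.update_of_ne (by omega), Function.update_of_ne (a := 0) (by omega)]
    rcases hj.lt_or_eq with hjn | rfl
    · rw [Function.update_of_ne (by omega), Function.update_of_ne (by omega)]
      congr 2
      refine f.2.mid (j - 1) (by omega) e he _ _ ?_ ?_ ?_
      · simp [Nat.sub_add_cancel hj0, proj_mul_right he]
      · simp [Nat.sub_add_cancel hj0, proj_mul_left he]
      · intro t ht ht'
        simp only [Function.update_apply]
        rw [if_neg (by omega), if_neg (by omega)]
    · rw [Function.update_of_ne (by omega), Function.update_self, ← mul_assoc]
      congr 1
      rw [mul_assoc (X 0)]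
      congr 1
      refine f.2.right hj0 e he _ _ ?_ ?_
      · simp [Nat.sub_add_cancel hj0, proj_mul_right he]
      · intro t ht
        simp only [Function.update_apply]
        rw [if_neg (by omega), if_neg (by omega)]

/-! ### From normalized cochains back to reduced cochains. -/

variable {D} in
theorem _root_.ReducedBracket.IsNormalized.apply_proj {n : ℕ} {f : HochschildCochain k A n}
    (hf : IsNormalized D.E f) (X : ℕ → A) : ev f X = ev f fun i => (D.proj (X i) : A) := by
  choose u hu hX using fun i => D.add_proj_mem (X i)
  have h := f.map_add_univ (fun i : Fin n => u i) (fun i : Fin n => (D.proj (X i) : A))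
  have e1 : ((fun i : Fin n => u i) + fun i : Fin n => (D.proj (X i) : A)) = fun i : Fin n => X i :=
    funext fun i => hX i
  -- Each X_i is u_i + π X_i with u_i in E. In the expansion over subsets, every nonempty subset
  -- places some u_i in an argument of f.
  rw [e1, Finset.sum_eq_single ∅] at h
  · simpa [ev] using h
  · intro s _ hs
    obtain ⟨i, hi⟩ := Finset.nonempty_iff_ne_empty.2 hs
    have := hf (fun j => if hj : j < n then
      s.piecewise (fun i : Fin n => u i) (fun i : Fin n => (D.proj (X i) : A)) ⟨j, hj⟩ else 0)
      i i.2 (by simpa [hi] using hu i)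
    simpa [ev] using this
  · simp

variable {D} in
theorem _root_.ReducedBracket.IsBalanced.isBimoduleMap {n : ℕ} {f : HochschildCochain k A n}
    (hf : IsBalanced D.E f) : D.IsBimoduleMap (f.compLinearMap fun _ => (rad k A).subtype) := by
  have apply_eq : ∀ z : Fin n → rad k A, f.compLinearMap (fun _ => (rad k A).subtype) z
      = ev f fun t => if ht : t < n then (z ⟨t, ht⟩ : A) else 0 := fun z => by
    simp only [ev, MultilinearMap.compLinearMap_apply, Fin.is_lt, dite_true]
    rfl
  refine ⟨?_, ?_, ?_, ?_⟩
  · rintro rfl e he x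
    rw [apply_eq]
    exact hf.mul_comm he _
  · intro hn e he x y h0 h1
    rw [apply_eq, apply_eq, ← hf.ev_update_mul_left hn he]
    refine ev_congr f fun t ht => ?_
    rcases eq_or_ne t 0 with rfl | h
    · simpa [hn] using h0
    · simp [ht, h, h1 ⟨t, ht⟩ h]
  · intro hn e he x y h0 h1
    rw [apply_eq, apply_eq, ← hf.ev_update_mul_right hn he]
    refine ev_congr f fun t ht => ?_
    rcases eq_or_ne t (n - 1) with rfl | h
    · simpa [hn] using h0
    · simp [ht, h, h1 ⟨t, ht⟩ h]
  · intro i hi e he x y h0 h1 h2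
    have hi' : i < n := by omega
    rw [apply_eq, apply_eq]
    -- The intermediate tuple is x with slot i taken from y. Multiplying its slot i by e on the
    -- right gives x, and its slot i + 1 by e on the left gives y.
    refine Eq.trans ?_ ((hf.ev_update_mul_mid hi he fun t => if ht : t < n then
      (if t = i then (y ⟨t, ht⟩ : A) else x ⟨t, ht⟩) else 0).trans ?_)
    · refine ev_congr f fun t ht => ?_
      rcases eq_or_ne t i with rfl | h
      · simpa [hi'] using h0
      · simp [ht, h]
    · refine ev_congr f fun t ht => ?_
      rcases eq_or_ne t (i + 1) with rfl | h
      · simpa [hi] using h1.symm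
      · rcases eq_or_ne t i with rfl | h'
        · simp [hi']
        · simp [ht, h, h', h2 ⟨t, ht⟩ h' h]

/-- The preimage is the restriction of f to r: balancedness makes it a bimodule map, and
normalization says that f depends only on the projections of its arguments. -/
theorem exists_pMap_eq {n : ℕ} {f : HochschildCochain k A n} (hf : IsNormalized D.E f)
    (hd : IsNormalized D.E (hochschildDiff k A n f)) : ∃ g, D.pMap n g = f := by
  refine ⟨⟨_, (hf.isBalanced hd).isBimoduleMap⟩, ev_ext fun X => ?_⟩
  rw [hf.apply_proj]
  rfl

/-- As p f is normalized and balanced, δ(p f) is normalized, so both sides depend only on the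
projected arguments. On r the two differentials agree, since π fixes products of elements of r. -/
theorem pMap_reducedDiff {n : ℕ} (f : D.reducedCochain n) :
    D.pMap (n + 1) (D.reducedDiff n f) = hochschildDiff k A n (D.pMap n f) := by
  refine ev_ext fun X => ?_
  rw [((D.isNormalized_pMap f).hochschildDiff (D.isBalanced_pMap f)).apply_proj, ev_pMap,
    ev_hochschildDiff]
  have h : (D.reducedDiff n f).1 = differential (rad k A).subtype (radMul k A) n f.1 := rfl
  rw [h, ev_differential]
  simp only [ev_pMap, proj_coe]
  congr 2
  refine Finset.sum_congr rfl fun i _ => ?_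
  congr 2
  funext j
  simp only [replaceBlock, merge_apply]
  split_ifs
  · rw [proj_coe]
  · exact (D.proj_coe _).symm
  · rw [proj_coe]

theorem pMap_reducedBracket {p q r : ℕ} (h : p + q = r) (f : D.reducedCochain (p + 1))
    (g : D.reducedCochain (q + 1)) : D.pMap (r + 1) (D.reducedBracket h f g) =
      gerstenhaberBracket k A h (D.pMap (p + 1) f) (D.pMap (q + 1) g) := by
  have key : ∀ {p q : ℕ} (h : p + q = r) (f : D.reducedCochain (p + 1))
      (g : D.reducedCochain (q + 1)) (X : ℕ → A),
      (ev (preLie D.proj h f.1 g.1) fun i => D.proj (X i)) =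
        ev (preLie LinearMap.id h (D.pMap (p + 1) f) (D.pMap (q + 1) g)) X := by
    intro p q h f g X
    rw [ev_preLie_proj, ev_preLie]
    refine Finset.sum_congr rfl fun i _ => ?_
    rw [ev_pMap]
    congr 2
    funext j
    simp only [replaceBlock]
    split_ifs <;> rfl
  refine ev_ext fun X => ?_
  rw [ev_pMap, reducedBracket_coe, gerstenhaberBracket_apply h (by omega), gradedCommutator_apply,
    ev_sub, ev_sub, ev_smul, ev_smul, key, key]

/-- A cochain with normalized differential is a reduced cochain up to a coboundary. -/
theorem exists_eq_pMap_add_hochschildDiff {n : ℕ} (f : HochschildCochain k A (n + 1))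
    (hd : IsNormalized D.E (hochschildDiff k A (n + 1) f)) :
    ∃ (g : D.reducedCochain (n + 1)) (h : HochschildCochain k A n),
      f = D.pMap (n + 1) g + hochschildDiff k A n h := by
  obtain ⟨h, hh⟩ := exists_sub_isNormalized D.idem_mem D.idem_mul_self D.sum_idem
    (fun x hx a => let ⟨c, hc⟩ := exists_scalar hx; ⟨c a, hc a⟩) f hd
  obtain ⟨g, hg⟩ := D.exists_pMap_eq hh
    (by rwa [map_sub, hochschildDiff_hochschildDiff, sub_zero])
  exact ⟨g, h, by rw [hg, sub_add_cancel]⟩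

/-- Injectivity on cohomology. Since p f is normalized, so is δg; hence g is a reduced cochain up to
a coboundary, which does not affect δg. In arity 0 normalization of g is vacuous. -/
theorem exists_reducedDiff_eq {n : ℕ} (f : D.reducedCochain (n + 1)) (g : HochschildCochain k A n)
    (h : D.pMap (n + 1) f = hochschildDiff k A n g) : ∃ g', D.reducedDiff n g' = f := by
  have hd : IsNormalized D.E (hochschildDiff k A n g) := h ▸ D.isNormalized_pMap f
  cases n with
  | zero =>
    obtain ⟨g', rfl⟩ := D.exists_pMap_eq (fun X j hj => absurd hj (by omega)) hd
    exact ⟨g', D.pMap_injective _ (by rw [pMap_reducedDiff, h])⟩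
  | succ n =>
    obtain ⟨g', b, rfl⟩ := D.exists_eq_pMap_add_hochschildDiff g hd
    rw [map_add, hochschildDiff_hochschildDiff, add_zero] at h
    exact ⟨g', D.pMap_injective _ (by rw [pMap_reducedDiff, h])⟩

/-! ### The map `s` is a left inverse of `p` -/

/-- Each right factor c_t moves across to the next entry, which already begins with c_t and absorbs
it by idempotence. -/
theorem _root_.ReducedBracket.IsBalanced.ev_corner {E : Subalgebra k A} {n : ℕ}
    {f : HochschildCochain k A n} (hf : IsBalanced E f) {c : ℕ → A} (hc : ∀ t, c t ∈ E)
    (hcc : ∀ t, c t * c t = c t) (x : ℕ → A) :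
    c 0 * (ev f fun t => c t * (x t * c (t + 1))) * c n = (ev f fun t => c t * x t) * c n := by
  -- W m interpolates in bar form: the right factors in slots t < m have been removed, so W 0 is the
  -- left-hand side and W (n + 1) the right-hand side.
  obtain ⟨W, hW⟩ : ∃ W : ℕ → ℕ → A, ∀ m t, W m t = (if t = 0 then 1 else c (t - 1)) *
      ((if t = 0 ∨ t = n + 1 then 1 else x (t - 1)) * if t < m ∨ n < t then 1 else c t) :=
    ⟨_, fun _ _ => rfl⟩
  have step : ∀ m ≤ n, ev (bar f) (W m) = ev (bar f) (W (m + 1)) := by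
    intro m hm
    have h := hf m hm (c m) (hc m) (W (m + 1))
    have e1 : Function.update (W (m + 1)) m (W (m + 1) m * c m) = W m := by
      funext t
      by_cases ht : t = m
      · subst ht
        simp [hW, hm.not_gt, mul_assoc]
      · have : t < m + 1 ↔ t < m := by omega
        simp [hW, ht, this]
    have e2 : Function.update (W (m + 1)) (m + 1) (c m * W (m + 1) (m + 1)) = W (m + 1) := by
      funext t
      by_cases ht : t = m + 1
      · subst ht
        rw [Function.update_self, hW, if_neg (by omega), Nat.add_sub_cancel, ← mul_assoc, hcc]
      · rw [Function.update_of_ne ht]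
    rwa [e1, e2] at h
  have all : ∀ m ≤ n + 1, ev (bar f) (W 0) = ev (bar f) (W m) := by
    intro m
    induction m with
    | zero => exact fun _ => rfl
    | succ m ih => exact fun hm => (ih (by omega)).trans (step m (by omega))
  have h := all (n + 1) le_rfl
  rw [ev_bar, ev_bar] at h
  have e1 : W 0 0 = c 0 := by simp [hW]
  have e2 : ∀ m, W m (n + 1) = c n := by simp [hW]
  have e3 : W (n + 1) 0 = 1 := by simp [hW]
  rw [e1, e2, e2, e3, one_mul] at h
  refine Eq.trans ?_ (h.trans ?_)
  · congr 2
    refine ev_congr f fun t ht => ?_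
    simp [hW, ht.ne, Nat.not_lt.2 (Nat.succ_le_of_lt ht)]
  · congr 1
    refine ev_congr f fun t ht => ?_
    simp [hW, ht.ne, ht]

theorem sMap_pMap {n : ℕ} (f : D.reducedCochain n) : D.sMap n (D.pMap n f) = f := by
  refine Subtype.ext (MultilinearMap.ext fun x => ?_)
  have h : (D.sMap n (D.pMap n f)).1 = D.sFormula (D.pMap n f) := rfl
  rw [h, sFormula_apply]
  -- The extra entry 1 lets the last idempotent be treated as one more argument of a multilinear
  -- map.
  set z : Fin (n + 1) → A := Fin.snoc (fun i => (x i : A)) 1 with hz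
  have e : ∀ j : Fin (n + 1) → Fin N, D.idem (j 0) *
      (D.pMap n f (fun i => D.idem (j i.castSucc) * (x i * D.idem (j i.succ))) *
        D.idem (j (Fin.last n))) =
      mulRightTerm LinearMap.id (D.pMap n f) fun i => D.idem (j i) * z i := by
    intro j
    -- The default value 1 outside the range is again an idempotent in E.
    set c : ℕ → A := fun t => if ht : t < n + 1 then D.idem (j ⟨t, ht⟩) else 1 with hc
    have h := (D.isBalanced_pMap f).ev_corner (c := c)
      (fun t => by
        simp only [hc]
        split_ifs
        exacts [D.idem_mem _, D.E.one_mem])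
      (fun t => by
        simp only [hc]
        split_ifs
        exacts [D.idem_mul_self _, mul_one 1])
      (fun t => if ht : t < n then (x ⟨t, ht⟩ : A) else 0)
    have hc' : ∀ i : Fin (n + 1), c i = D.idem (j i) := fun i => dif_pos i.2
    have h0 : c 0 = D.idem (j 0) := hc' 0
    have hn : c n = D.idem (j (Fin.last n)) := hc' (Fin.last n)
    rw [h0, hn, mul_assoc] at h
    refine Eq.trans ?_ (h.trans ?_)
    · congr 2
      refine congrArg _ (funext fun i => ?_)
      have h1 : c i = D.idem (j i.castSucc) := hc' i.castSucc
      have h2 : c (i + 1) = D.idem (j i.succ) := hc' i.succ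
      simp [h1, h2]
    · have h3 : mulRightTerm LinearMap.id (D.pMap n f) (fun i => D.idem (j i) * z i)
          = D.pMap n f (fun i : Fin n => D.idem (j i.castSucc) * z i.castSucc) *
            (D.idem (j (Fin.last n)) * z (Fin.last n)) := rfl
      rw [h3]
      congr 1
      · refine congrArg (D.pMap n f) (funext fun i => ?_)
        have h1 : c i = D.idem (j i.castSucc) := hc' i.castSucc
        simp [h1, hz]
      · simp [hz]
  -- Each slot now involves its own index only, so by multilinearity the sum over all tuples becomes
  -- ∑ e_a = 1 in every slot.
  rw [Finset.sum_congr rfl fun j _ => e j,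
    ← MultilinearMap.map_sum _ (fun i a => D.idem a * z i)]
  simp only [← Finset.sum_mul, sum_idem, one_mul]
  have h3 : mulRightTerm LinearMap.id (D.pMap n f) z
      = D.pMap n f (fun i : Fin n => z i.castSucc) * z (Fin.last n) := rfl
  rw [h3]
  simp only [hz, Fin.snoc_castSucc, Fin.snoc_last, mul_one]
  exact D.pMap_apply_coe f x

end RadicalSplitting

end Comparison

end ReducedBracket

end

noncomputable section

namespace ReducedBracket

/-! ### The brackets on cohomology -/

section Cohomology

variable {k A : Type*} [Field k] [Ring A] [Algebra k A]

theorem cohomologyClass_eq_zero_iff {C : ℕ → Type*} [∀ n, AddCommGroup (C n)]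
    [∀ n, Module k (C n)] (d : ∀ n, C n →ₗ[k] C (n + 1)) {p : ℕ} (f : Cocycle d p) :
    cohomologyClass d p f = 0 ↔ ∃ c, d p c = f.1 := by
  rw [Submodule.mkQ_apply, Submodule.Quotient.mk_eq_zero]
  rfl

section Comparison

variable {C C' : ℕ → Type*} [∀ n, AddCommGroup (C n)] [∀ n, Module k (C n)]
  [∀ n, AddCommGroup (C' n)] [∀ n, Module k (C' n)] (d : ∀ n, C n →ₗ[k] C (n + 1))
  (d' : ∀ n, C' n →ₗ[k] C' (n + 1)) (φ : ∀ n, C n →ₗ[k] C' n)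
  (hφ : ∀ n c, φ (n + 1) (d n c) = d' n (φ n c))

theorem map_mem_cocycle (hφ : ∀ n c, φ (n + 1) (d n c) = d' n (φ n c)) {p : ℕ}
    (f : Cocycle d p) : φ (p + 1) f.1 ∈ Cocycle d' p := by
  have hf : d (p + 1) f.1 = 0 := f.2
  rw [LinearMap.mem_ker, ← hφ, hf, map_zero]

/-- The map sending a cocycle to the class of its image under a morphism of complexes. -/
def cocycleToCohomology (p : ℕ) : Cocycle d p →ₗ[k] CohomologySucc d' p :=
  cohomologyClass d' p ∘ₗ
    ((φ (p + 1)).domRestrict (Cocycle d p)).codRestrict _ (map_mem_cocycle d d' φ hφ)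

theorem ker_cocycleToCohomology {p : ℕ}
    (hinj : ∀ f b, φ (p + 1) f = d' p b → ∃ c, d p c = f) :
    LinearMap.ker (cocycleToCohomology d d' φ hφ p) =
      (LinearMap.range (d p)).submoduleOf (Cocycle d p) := by
  ext f
  refine (cohomologyClass_eq_zero_iff d' _).trans ?_
  constructor
  · rintro ⟨c, hc⟩
    exact hinj f.1 c hc.symm
  · rintro ⟨c, hc⟩
    refine ⟨φ p c, ?_⟩
    rw [← hφ, hc]
    rfl

/-- The class of g maps to that of f because φ g - f is the coboundary of -b. -/
theorem cocycleToCohomology_surjective {p : ℕ}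
    (hsurj : ∀ f, d' (p + 1) f = 0 → ∃ g b, d (p + 1) g = 0 ∧ f = φ (p + 1) g + d' p b) :
    Function.Surjective (cocycleToCohomology d d' φ hφ p) := by
  intro x
  obtain ⟨f, rfl⟩ := Submodule.mkQ_surjective _ x
  obtain ⟨g, b, hg, hf⟩ := hsurj f.1 f.2
  refine ⟨⟨g, hg⟩, ?_⟩
  rw [← sub_eq_zero, cocycleToCohomology, LinearMap.comp_apply, ← map_sub]
  refine (cohomologyClass_eq_zero_iff d' _).2 ⟨-b, ?_⟩
  have e : d' p (-b) = φ (p + 1) g - f.1 := by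
    rw [hf, map_neg]
    abel
  exact e

/-- A morphism of complexes which is bijective on cohomology gives an isomorphism. -/
def cohomologyEquivOfBijective {p : ℕ}
    (hinj : ∀ f b, φ (p + 1) f = d' p b → ∃ c, d p c = f)
    (hsurj : ∀ f, d' (p + 1) f = 0 → ∃ g b, d (p + 1) g = 0 ∧ f = φ (p + 1) g + d' p b) :
    CohomologySucc d p ≃ₗ[k] CohomologySucc d' p :=
  (Submodule.quotEquivOfEq _ _ (ker_cocycleToCohomology d d' φ hφ hinj).symm).trans
    ((cocycleToCohomology d d' φ hφ p).quotKerEquivOfSurjective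
      (cocycleToCohomology_surjective d d' φ hφ hsurj))

theorem cohomologyEquivOfBijective_apply {p : ℕ}
    (hinj : ∀ f b, φ (p + 1) f = d' p b → ∃ c, d p c = f)
    (hsurj : ∀ f, d' (p + 1) f = 0 → ∃ g b, d (p + 1) g = 0 ∧ f = φ (p + 1) g + d' p b)
    (f : Cocycle d p) :
    cohomologyEquivOfBijective d d' φ hφ hinj hsurj (cohomologyClass d p f) =
      cohomologyClass d' p ⟨φ (p + 1) f.1, map_mem_cocycle d d' φ hφ f⟩ := rfl

end Comparison

/-! ### Descent of the Gerstenhaber bracket to cohomology. -/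

theorem gerstenhaberBracket_mem {p q r : ℕ} (h : p + q = r) (f : HochschildCocycle k A p)
    (g : HochschildCocycle k A q) :
    gerstenhaberBracket k A h f.1 g.1 ∈ HochschildCocycle k A r := by
  have hf : hochschildDiff k A (p + 1) f.1 = 0 := f.2
  have hg : hochschildDiff k A (q + 1) g.1 = 0 := g.2
  rw [LinearMap.mem_ker, hochschildDiff_gerstenhaberBracket h (by omega) (by omega), hf, hg]
  simp

/-- The bracket of a cocycle with a coboundary is a coboundary. -/
theorem exists_hochschildDiff_eq_bracket {p q r : ℕ} (h : p + q = r) (f : HochschildCocycle k A p)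
    (c : HochschildCochain k A q) :
    ∃ b, hochschildDiff k A r b = gerstenhaberBracket k A h f.1 (hochschildDiff k A q c) := by
  have hf : hochschildDiff k A (p + 1) f.1 = 0 := f.2
  cases q with
  -- Here c has degree -1 and cannot be bracketed, so the explicit primitive for inner derivations
  -- is used.
  | zero =>
    subst h
    exact ⟨_, (gerstenhaberBracket_hochschildDiff_zero f.1 hf c).symm⟩
  | succ q =>
    subst h
    -- By Leibniz and δf = 0, the bracket of f with c is a primitive.
    refine ⟨gerstenhaberBracket k A rfl f.1 c, ?_⟩
    have e := hochschildDiff_gerstenhaberBracket (rfl : p + q = p + q) rfl (by omega) f.1 c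
    rw [hf, map_zero, LinearMap.zero_apply, smul_zero, add_zero] at e
    exact e

theorem exists_hochschildDiff_eq_bracket_left {p q r : ℕ} (h : p + q = r)
    (c : HochschildCochain k A p) (g : HochschildCocycle k A q) :
    ∃ b, hochschildDiff k A r b = gerstenhaberBracket k A h (hochschildDiff k A p c) g.1 := by
  obtain ⟨b, hb⟩ := exists_hochschildDiff_eq_bracket (by omega : q + p = r) g c
  refine ⟨-((-1 : k) ^ (p * q) • b), ?_⟩
  rw [map_neg, map_smul, hb]
  exact (gerstenhaberBracket_isGradedLieBracket.antisymm h (by omega) _ g.1).symm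

variable (k A) in
/-- The class of the bracket of two cocycles. -/
def bracketClass {p q r : ℕ} (h : p + q = r) :
    HochschildCocycle k A p →ₗ[k] HochschildCocycle k A q →ₗ[k] HochschildHH k A r :=
  LinearMap.mk₂ k
    (fun f g => hochschildClass k A r
      ⟨gerstenhaberBracket k A h f.1 g.1, gerstenhaberBracket_mem h f g⟩)
    (fun f f' g => by
      rw [← map_add]
      exact congrArg _ (Subtype.ext (by simp)))
    (fun c f g => by
      rw [← map_smul]
      exact congrArg _ (Subtype.ext (by simp)))
    (fun f g g' => by
      rw [← map_add]
      exact congrArg _ (Subtype.ext (by simp)))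
    (fun c f g => by
      rw [← map_smul]
      exact congrArg _ (Subtype.ext (by simp)))

theorem bracketClass_apply {p q r : ℕ} (h : p + q = r) (f : HochschildCocycle k A p)
    (g : HochschildCocycle k A q) : bracketClass k A h f g = hochschildClass k A r
      ⟨gerstenhaberBracket k A h f.1 g.1, gerstenhaberBracket_mem h f g⟩ := rfl

theorem exists_bracketHH {p q r : ℕ} (h : p + q = r) :
    ∃ br : HochschildHH k A p →ₗ[k] HochschildHH k A q →ₗ[k] HochschildHH k A r,
      ∀ f g, br (hochschildClass k A p f) (hochschildClass k A q g) = bracketClass k A h f g := by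
  refine ⟨(bracketClass k A h).liftQ₂ _ _ ?_ ?_, fun f g => rfl⟩
  · rintro f ⟨c, hc⟩
    refine LinearMap.mem_ker.2 (LinearMap.ext fun g => ?_)
    rw [bracketClass_apply]
    refine (cohomologyClass_eq_zero_iff (C := HochschildCochain k A) (hochschildDiff k A) _).2 ?_
    obtain ⟨b, hb⟩ := exists_hochschildDiff_eq_bracket_left h c g
    exact ⟨b, by rw [hb, hc]; rfl⟩
  · rintro g ⟨c, hc⟩
    refine LinearMap.mem_ker.2 (LinearMap.ext fun f => ?_)
    rw [LinearMap.flip_apply, bracketClass_apply]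
    refine (cohomologyClass_eq_zero_iff (C := HochschildCochain k A) (hochschildDiff k A) _).2 ?_
    obtain ⟨b, hb⟩ := exists_hochschildDiff_eq_bracket h f c
    exact ⟨b, by rw [hb, hc]; rfl⟩

variable (k A) in
/-- The Gerstenhaber bracket on Hochschild cohomology. -/
def bracketHH {p q r : ℕ} (h : p + q = r) :
    HochschildHH k A p →ₗ[k] HochschildHH k A q →ₗ[k] HochschildHH k A r :=
  (exists_bracketHH h).choose

theorem bracketHH_apply {p q r : ℕ} (h : p + q = r) (f : HochschildCocycle k A p)
    (g : HochschildCocycle k A q) :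
    bracketHH k A h (hochschildClass k A p f) (hochschildClass k A q g) = hochschildClass k A r
      ⟨gerstenhaberBracket k A h f.1 g.1, gerstenhaberBracket_mem h f g⟩ :=
  (exists_bracketHH h).choose_spec f g

theorem bracketHH_isGradedLieBracket :
    IsGradedLieBracket (k := k) (L := HochschildHH k A) (fun {_ _ _} h => bracketHH k A h) where
  antisymm {p q s} h h' x y := by
    obtain ⟨f, rfl⟩ := Submodule.mkQ_surjective _ x
    obtain ⟨g, rfl⟩ := Submodule.mkQ_surjective _ y
    rw [bracketHH_apply, bracketHH_apply, ← map_smul, ← map_neg]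
    exact congrArg _ (Subtype.ext
      (gerstenhaberBracket_isGradedLieBracket.antisymm h h' f.1 g.1))
  jacobi {p q r qr rp pq s} hqr hrp hpq h₁ h₂ h₃ x y z := by
    obtain ⟨f, rfl⟩ := Submodule.mkQ_surjective _ x
    obtain ⟨g, rfl⟩ := Submodule.mkQ_surjective _ y
    obtain ⟨h, rfl⟩ := Submodule.mkQ_surjective _ z
    rw [bracketHH_apply, bracketHH_apply, bracketHH_apply, bracketHH_apply, bracketHH_apply,
      bracketHH_apply, ← map_smul, ← map_smul, ← map_smul, ← map_add, ← map_add]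
    refine (congrArg _ (Subtype.ext ?_)).trans (map_zero (hochschildClass k A s))
    exact gerstenhaberBracket_isGradedLieBracket.jacobi hqr hrp hpq h₁ h₂ h₃ f.1 g.1 h.1

/-- A graded Lie bracket can be pulled back along injective linear maps. -/
theorem IsGradedLieBracket.of_injective {L L' : ℕ → Type*} [∀ p, AddCommGroup (L p)]
    [∀ p, Module k (L p)] [∀ p, AddCommGroup (L' p)] [∀ p, Module k (L' p)]
    {br : ∀ {p q r : ℕ}, p + q = r → (L p →ₗ[k] L q →ₗ[k] L r)}
    {br' : ∀ {p q r : ℕ}, p + q = r → (L' p →ₗ[k] L' q →ₗ[k] L' r)}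
    (hbr : IsGradedLieBracket (k := k) (L := L) (fun {_ _ _} h => br h))
    (φ : ∀ p, L' p →ₗ[k] L p) (hφ : ∀ p, Function.Injective (φ p))
    (hφbr : ∀ {p q r : ℕ} (h : p + q = r) (x : L' p) (y : L' q),
      φ r (br' h x y) = br h (φ p x) (φ q y)) :
    IsGradedLieBracket (k := k) (L := L') (fun {_ _ _} h => br' h) where
  antisymm {p q s} h h' x y := by
    apply hφ
    rw [map_neg, map_smul, hφbr, hφbr]
    exact hbr.antisymm h h' _ _
  jacobi {p q r qr rp pq s} hqr hrp hpq h₁ h₂ h₃ x y z := by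
    apply hφ
    rw [map_add, map_add, map_smul, map_smul, map_smul, map_zero]
    simp only [hφbr]
    exact hbr.jacobi hqr hrp hpq h₁ h₂ h₃ _ _ _

/-! ### Transport to the reduced complex. -/

namespace RadicalSplitting

variable {N : ℕ} (D : RadicalSplitting k A N)

theorem reducedBracket_isGradedLieBracket :
    IsGradedLieBracket (k := k) (L := fun p => D.reducedCochain (p + 1))
      (fun {_ _ _} h => D.reducedBracket h) :=
  gerstenhaberBracket_isGradedLieBracket.of_injective (fun p => D.pMap (p + 1))
    (fun _ => D.pMap_injective _) D.pMap_reducedBracket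

theorem reducedDiff_reducedBracket {p q r : ℕ} (h : p + q = r) (h₁ : p + (q + 1) = r + 1)
    (h₂ : p + 1 + q = r + 1) (f : D.reducedCochain (p + 1)) (g : D.reducedCochain (q + 1)) :
    D.reducedDiff (r + 1) (D.reducedBracket h f g) =
      D.reducedBracket h₁ f (D.reducedDiff (q + 1) g)
        + (-1 : k) ^ q • D.reducedBracket h₂ (D.reducedDiff (p + 1) f) g := by
  apply D.pMap_injective
  rw [map_add, map_smul, pMap_reducedDiff, pMap_reducedBracket, pMap_reducedBracket,
    pMap_reducedBracket, pMap_reducedDiff, pMap_reducedDiff,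
    hochschildDiff_gerstenhaberBracket h h₁ h₂]

theorem pMap_mem {p : ℕ} (f : D.ReducedCocycle p) :
    D.pMap (p + 1) f.1 ∈ HochschildCocycle k A p := by
  have hf : D.reducedDiff (p + 1) f.1 = 0 := f.2
  rw [LinearMap.mem_ker, ← pMap_reducedDiff, hf, map_zero]

theorem reducedBracket_mem {p q r : ℕ} (h : p + q = r) (f : D.ReducedCocycle p)
    (g : D.ReducedCocycle q) : D.reducedBracket h f.1 g.1 ∈ D.ReducedCocycle r := by
  have hf : D.reducedDiff (p + 1) f.1 = 0 := f.2
  have hg : D.reducedDiff (q + 1) g.1 = 0 := g.2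
  rw [LinearMap.mem_ker, D.reducedDiff_reducedBracket h (by omega) (by omega), hf, hg]
  simp

/-- Surjectivity on cohomology: the differential of a cocycle is zero, hence normalized, and
injectivity of p makes the reduced representative a cocycle. -/
theorem exists_reducedCocycle {p : ℕ} (f : HochschildCochain k A (p + 1))
    (hf : hochschildDiff k A (p + 1) f = 0) :
    ∃ (g : D.reducedCochain (p + 1)) (b : HochschildCochain k A p),
      D.reducedDiff (p + 1) g = 0 ∧ f = D.pMap (p + 1) g + hochschildDiff k A p b := by
  obtain ⟨g, b, hg⟩ := D.exists_eq_pMap_add_hochschildDiff f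
    (by rw [hf]; exact fun X _ _ _ => by simp [ev])
  refine ⟨g, b, ?_, hg⟩
  rw [hg, map_add, hochschildDiff_hochschildDiff, add_zero] at hf
  apply D.pMap_injective
  rw [pMap_reducedDiff, map_zero, hf]

/-- The isomorphism induced by `p` on cohomology. -/
def cohomologyEquiv (p : ℕ) : D.ReducedHH p ≃ₗ[k] HochschildHH k A p := by
  have Φ := @cohomologyEquivOfBijective k _ (fun n => D.reducedCochain n) (HochschildCochain k A)
    _ _ _ _ D.reducedDiff (hochschildDiff k A) D.pMap (fun _ => D.pMap_reducedDiff) p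
    (fun f b h => D.exists_reducedDiff_eq f b h) (fun f hf => D.exists_reducedCocycle f hf)
  with_reducible exact Φ

theorem cohomologyEquiv_apply {p : ℕ} (f : D.ReducedCocycle p) :
    D.cohomologyEquiv p (D.reducedClass p f) =
      hochschildClass k A p ⟨D.pMap (p + 1) f.1, D.pMap_mem f⟩ := by
  have e := @cohomologyEquivOfBijective_apply k _ (fun n => D.reducedCochain n)
    (HochschildCochain k A) _ _ _ _ D.reducedDiff (hochschildDiff k A) D.pMap
    (fun _ => D.pMap_reducedDiff) p
    (fun f b h => D.exists_reducedDiff_eq f b h) (fun f hf => D.exists_reducedCocycle f hf)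
  unfold cohomologyEquiv
  with_reducible exact e f

/-- The reduced bracket on cohomology. -/
def reducedBracketHH {p q r : ℕ} (h : p + q = r) :
    D.ReducedHH p →ₗ[k] D.ReducedHH q →ₗ[k] D.ReducedHH r :=
  ((bracketHH k A h).compl₁₂ (D.cohomologyEquiv p).toLinearMap
    (D.cohomologyEquiv q).toLinearMap).compr₂ (D.cohomologyEquiv r).symm.toLinearMap

theorem cohomologyEquiv_reducedBracketHH {p q r : ℕ} (h : p + q = r) (x : D.ReducedHH p)
    (y : D.ReducedHH q) : D.cohomologyEquiv r (D.reducedBracketHH h x y) =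
      bracketHH k A h (D.cohomologyEquiv p x) (D.cohomologyEquiv q y) :=
  (D.cohomologyEquiv r).apply_symm_apply _

/-- The bracket on reduced cohomology is defined by transport of structure; this identifies it with
the one induced by the reduced bracket of representatives. -/
theorem reducedBracketHH_apply {p q r : ℕ} (h : p + q = r) (f : D.ReducedCocycle p)
    (g : D.ReducedCocycle q) :
    D.reducedBracketHH h (D.reducedClass p f) (D.reducedClass q g) =
      D.reducedClass r ⟨D.reducedBracket h f.1 g.1, D.reducedBracket_mem h f g⟩ := by
  apply (D.cohomologyEquiv r).injective
  rw [cohomologyEquiv_reducedBracketHH, cohomologyEquiv_apply, cohomologyEquiv_apply,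
    cohomologyEquiv_apply, bracketHH_apply]
  exact congrArg _ (Subtype.ext (D.pMap_reducedBracket h f.1 g.1).symm)

end RadicalSplitting

end Cohomology

end ReducedBracket

end

/-! ### The main theorem. -/

theorem mainTheorem3 {k A : Type*} [Field k] [Ring A] [Algebra k A] [FiniteDimensional k A]
    {N : ℕ} (D : ReducedBracket.RadicalSplitting k A N) :
    -- the Gerstenhaber bracket and the reduced bracket are graded Lie brackets on cochains
    ReducedBracket.IsGradedLieBracket (k := k)
      (L := fun p => ReducedBracket.HochschildCochain k A (p + 1))
      (fun {_ _ _} h => ReducedBracket.gerstenhaberBracket k A h) ∧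
    ReducedBracket.IsGradedLieBracket (k := k) (L := fun p => D.reducedCochain (p + 1))
      (fun {_ _ _} h => D.reducedBracket h) ∧
    -- the reduced bracket is obtained by transport along the comparison maps
    (∀ {p q r : ℕ} (h : p + q = r) (f : D.reducedCochain (p + 1)) (g : D.reducedCochain (q + 1)),
      D.reducedBracket h f g = D.sMap (r + 1)
        (ReducedBracket.gerstenhaberBracket k A h (D.pMap (p + 1) f) (D.pMap (q + 1) g))) ∧
    -- `p^*` is a morphism of graded Lie algebras
    (∀ {p q r : ℕ} (h : p + q = r) (f : D.reducedCochain (p + 1)) (g : D.reducedCochain (q + 1)),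
      D.pMap (r + 1) (D.reducedBracket h f g) =
        ReducedBracket.gerstenhaberBracket k A h (D.pMap (p + 1) f) (D.pMap (q + 1) g)) ∧
    -- `p` is a morphism of complexes
    (∀ (n : ℕ) (f : D.reducedCochain n),
      D.pMap (n + 1) (D.reducedDiff n f) =
        ReducedBracket.hochschildDiff k A n (D.pMap n f)) ∧
    -- `δ [f, g]_R = [f, δ g]_R + (-1)^{m-1} [δ f, g]_R`, with `m = q + 1`
    (∀ {p q r : ℕ} (h : p + q = r) (f : D.reducedCochain (p + 1)) (g : D.reducedCochain (q + 1)),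
      D.reducedDiff (r + 1) (D.reducedBracket h f g) =
        D.reducedBracket (by omega : p + (q + 1) = r + 1) f (D.reducedDiff (q + 1) g) +
        (-1 : k) ^ q •
          D.reducedBracket (by omega : p + 1 + q = r + 1) (D.reducedDiff (p + 1) f) g) ∧
    -- both brackets descend to graded Lie brackets on `HH^{*+1}(A)`, computed by the reduced
    -- complex and by the Hochschild complex, and `p` induces an isomorphism between them
    ∃ (brR : ∀ {p q r : ℕ}, p + q = r →
        (D.ReducedHH p →ₗ[k]
          D.ReducedHH q →ₗ[k]
            D.ReducedHH r))
      (brG : ∀ {p q r : ℕ}, p + q = r →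
        (ReducedBracket.HochschildHH k A p →ₗ[k]
          ReducedBracket.HochschildHH k A q →ₗ[k]
            ReducedBracket.HochschildHH k A r))
      (Φ : ∀ p : ℕ, D.ReducedHH p ≃ₗ[k]
        ReducedBracket.HochschildHH k A p),
      (∀ {p q r : ℕ} (h : p + q = r) (f : D.ReducedCocycle p)
        (g : D.ReducedCocycle q),
        ∃ hc : D.reducedBracket h f.1 g.1 ∈ D.ReducedCocycle r,
          brR h (D.reducedClass p f)
              (D.reducedClass q g) =
            D.reducedClass r ⟨D.reducedBracket h f.1 g.1, hc⟩) ∧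
      (∀ {p q r : ℕ} (h : p + q = r)
        (f : ReducedBracket.HochschildCocycle k A p)
        (g : ReducedBracket.HochschildCocycle k A q),
        ∃ hc : ReducedBracket.gerstenhaberBracket k A h f.1 g.1 ∈
            ReducedBracket.HochschildCocycle k A r,
          brG h (ReducedBracket.hochschildClass k A p f)
              (ReducedBracket.hochschildClass k A q g) =
            ReducedBracket.hochschildClass k A r
              ⟨ReducedBracket.gerstenhaberBracket k A h f.1 g.1, hc⟩) ∧
      (∀ (p : ℕ) (f : D.ReducedCocycle p),
        ∃ hc : D.pMap (p + 1) f.1 ∈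
            ReducedBracket.HochschildCocycle k A p,
          Φ p (D.reducedClass p f) =
            ReducedBracket.hochschildClass k A p
              ⟨D.pMap (p + 1) f.1, hc⟩) ∧
      ReducedBracket.IsGradedLieBracket (k := k)
        (L := D.ReducedHH) (fun {_ _ _} h => brR h) ∧
      ReducedBracket.IsGradedLieBracket (k := k)
        (L := ReducedBracket.HochschildHH k A) (fun {_ _ _} h => brG h) ∧
      (∀ {p q r : ℕ} (h : p + q = r) (x : D.ReducedHH p)
        (y : D.ReducedHH q),
        Φ r (brR h x y) = brG h (Φ p x) (Φ q y)) := by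
  refine ⟨ReducedBracket.gerstenhaberBracket_isGradedLieBracket,
    D.reducedBracket_isGradedLieBracket, fun h f g => ?_, D.pMap_reducedBracket,
    fun _ => D.pMap_reducedDiff, fun h f g => D.reducedDiff_reducedBracket h _ _ f g,
    fun h => D.reducedBracketHH h, fun h => ReducedBracket.bracketHH k A h, D.cohomologyEquiv,
    fun h f g => ⟨D.reducedBracket_mem h f g, D.reducedBracketHH_apply h f g⟩,
    fun h f g => ⟨ReducedBracket.gerstenhaberBracket_mem h f g,
      ReducedBracket.bracketHH_apply h f g⟩,
    fun p f => ⟨D.pMap_mem f, D.cohomologyEquiv_apply f⟩,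
    ReducedBracket.bracketHH_isGradedLieBracket.of_injective
      (fun p => (D.cohomologyEquiv p).toLinearMap) (fun p => (D.cohomologyEquiv p).injective)
      D.cohomologyEquiv_reducedBracketHH,
    ReducedBracket.bracketHH_isGradedLieBracket, D.cohomologyEquiv_reducedBracketHH⟩
  -- The formula through s follows from compatibility of p with the brackets and s p = id.
  rw [← D.pMap_reducedBracket, D.sMap_pMap]
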